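/- Let $\mathbb F$ be an algebraically closed field. Let $f\colon X\dashrightarrow\mathbb P^n$ and $g\colon Y\dashrightarrow\mathbb P^n$ be rational maps over $\mathbb F$ with $X,Y\in\{\mathbb P^2,\mathbb P^1\times\mathbb P^1\}$, each given by $n+1$ forms of the same (bi)degree, called its component degree $\operatorname{cdeg}$, whose greatest common divisor is constant. Let $\operatorname{img}$ denote the Zariski closure of the image; assume that $\operatorname{img} f$ and $\operatorname{img} g$ are not contained in hyperplanes and that $f$ and $g$ are birational onto their images. Put $$\mathcal P(f,g)=\{p\in\operatorname{Aut}(\mathbb P^n) : p(\operatorname{img} f)=\operatorname{img} g\},$$ $$\mathcal R(f,g)=\{r\colon X\dashrightarrow Y \text{ birational} : p\circ f=g\circ r \text{ for some } p\in\mathcal P(f,g)\}.$$ Let $(r_c)_{c\in\mathcal I}$, with $\mathcal I\subseteq\mathbb F^t$, be a family of birational maps $X\dashrightarrow Y$ that contains every element of $\mathcal R(f,g)$. The components of $g\circ r_c$ are obtained by substitution, after which the greatest common divisor is factored out (they are unique up to a common nonzero scalar). Let $v$ be a column vector whose $m$ entries form a basis of the vector space of all forms on $X$ of (bi)degree $\operatorname{cdeg}(f)$.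 For a tuple $h$ of $n+1$ such forms let $M_h$ be the $(n+1)\times m$ matrix with $M_h\cdot v=h$. Let $K=\ker M_f$ be a matrix whose columns form a basis of the kernel of $M_f$, and let $E_h=(M_h^\top\mid K)^\top$, which is an $m\times m$ matrix. Let $$\mathcal J=\{c\in\mathcal I : g\circ r_c \text{ has the same base points as } f,\ \operatorname{cdeg}(g\circ r_c)=\operatorname{cdeg}(f),\ M_{g\circ r_c}\cdot K=\mathbf 0\},$$ where base points include infinitely near ones and are taken with their multiplicities. For an $(n+1)\times(n+1)$ matrix $U$ let $\chi_U$ be the corresponding projective linear map. Then $$\mathcal P(f,g)=\{\chi_U\in\operatorname{Aut}(\mathbb P^n) : (U\oplus\mathbf 1)\cdot E_f=E_{g\circ r_c}\text{ for some } c\in\mathcal J\}.$$ In particular, if $E_f$ is invertible, then $$\mathcal P(f,g)=\{\chi_U\in\operatorname{Aut}(\mathbb P^n) : U\oplus\mathbf 1=E_{g\circ r_c}\cdot E_f^{-1}\text{ for some } c\in\mathcal J\}.$$ -/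

import Mathlib

open MvPolynomial
open scoped LinearAlgebra.Projectivization

/-! ### The domains: the projective plane and the product of two projective lines -/

/-- The two possible domains of a parametrization: `ℙ²` and `ℙ¹ × ℙ¹`. -/
inductive Dom : Type
  | P2
  | P1P1

namespace Dom

/-- The projective factors of the domain: one for `ℙ²`, two for `ℙ¹ × ℙ¹`. -/
def Factor : Dom → Type
  | P2 => Fin 1
  | P1P1 => Fin 2

/-- The homogeneous coordinates: `x 0, x 1, x 2` on `ℙ²`, and `y (b, 0), y (b, 1)` on the
`b`-th factor of `ℙ¹ × ℙ¹`. -/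
def Var : Dom → Type
  | P2 => Fin 3
  | P1P1 => Fin 2 × Fin 2

/-- The factor to which a homogeneous coordinate belongs. -/
def factor : (X : Dom) → X.Var → X.Factor
  | P2 => fun _ => (0 : Fin 1)
  | P1P1 => fun y => Prod.fst (α := Fin 2) (β := Fin 2) y

instance (X : Dom) : Fintype X.Factor :=
  match X with
  | P2 => inferInstanceAs (Fintype (Fin 1))
  | P1P1 => inferInstanceAs (Fintype (Fin 2))

instance (X : Dom) : DecidableEq X.Factor :=
  match X with
  | P2 => inferInstanceAs (DecidableEq (Fin 1))
  | P1P1 => inferInstanceAs (DecidableEq (Fin 2))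

instance (X : Dom) : Fintype X.Var :=
  match X with
  | P2 => inferInstanceAs (Fintype (Fin 3))
  | P1P1 => inferInstanceAs (Fintype (Fin 2 × Fin 2))

instance (X : Dom) : DecidableEq X.Var :=
  match X with
  | P2 => inferInstanceAs (DecidableEq (Fin 3))
  | P1P1 => inferInstanceAs (DecidableEq (Fin 2 × Fin 2))

theorem factor_surjective (X : Dom) (b : X.Factor) : ∃ x, X.factor x = b := by
  cases X with
  | P2 => exact ⟨(0 : Fin 3), Subsingleton.elim (α := Fin 1) _ _⟩
  | P1P1 => exact ⟨((b, 0) : Fin 2 × Fin 2), rfl⟩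

/-- Degrees of forms: a natural number on `ℙ²`, a bidegree on `ℙ¹ × ℙ¹`. -/
abbrev Deg (X : Dom) : Type := X.Factor → ℕ

/-- The (bi)degree of a homogeneous coordinate. -/
def weight (X : Dom) (x : X.Var) : X.Deg := Pi.single (X.factor x) 1

/-- The vector space of all forms of (bi)degree `d` on the domain. -/
noncomputable def forms (F : Type*) [Field F] (X : Dom) (d : X.Deg) :
    Submodule F (MvPolynomial X.Var F) :=
  weightedHomogeneousSubmodule F X.weight d

/-- A coordinate vector represents a point of the domain if it is nonzero in each factor. -/
def IsPoint {F : Type*} [Field F] (X : Dom) (a : X.Var → F) : Prop :=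
  ∀ b, ∃ x, X.factor x = b ∧ a x ≠ 0

end Dom

/-! ### Subsets and automorphisms of projective space -/

section ProjectiveSpace

variable {F : Type*} [Field F] {n : ℕ}

/-- The Zariski closure of a subset of `ℙⁿ`. -/
def zariskiClosure (S : Set (ℙ F (Fin (n + 1) → F))) : Set (ℙ F (Fin (n + 1) → F)) :=
  {P : ℙ F (Fin (n + 1) → F) | ∀ (d : ℕ) (q : MvPolynomial (Fin (n + 1)) F),
    q.IsHomogeneous d → (∀ Q ∈ S, eval Q.rep q = 0) → eval P.rep q = 0}

/-- The hyperplane `∑ i, a i * z i = 0`. -/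
def hyperplane (a : Fin (n + 1) → F) : Set (ℙ F (Fin (n + 1) → F)) :=
  {P : ℙ F (Fin (n + 1) → F) | ∑ i, a i * P.rep i = 0}

/-- A self-map of `ℙⁿ` is regular if near each point it is given by forms of the same degree. -/
def IsRegularMap (p : ℙ F (Fin (n + 1) → F) → ℙ F (Fin (n + 1) → F)) : Prop :=
  ∀ P : ℙ F (Fin (n + 1) → F), ∃ (d : ℕ) (φ : Fin (n + 1) → MvPolynomial (Fin (n + 1)) F),
    (∀ i, (φ i).IsHomogeneous d) ∧ (fun i => eval P.rep (φ i)) ≠ 0 ∧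
    ∀ (z : Fin (n + 1) → F) (hz : z ≠ 0) (hφ : (fun i => eval z (φ i)) ≠ 0),
      p (.mk F z hz) = .mk F (fun i => eval z (φ i)) hφ

/-- The biregular automorphisms of `ℙⁿ`. -/
def projAut (F : Type*) [Field F] (n : ℕ) :
    Set (ℙ F (Fin (n + 1) → F) ≃ ℙ F (Fin (n + 1) → F)) :=
  {p | IsRegularMap p ∧ IsRegularMap p.symm}

/-- `p` is the projective linear map `χ_U` that corresponds to the matrix `U`. -/
def IsProjLinear (U : Matrix (Fin (n + 1)) (Fin (n + 1)) F)
    (p : ℙ F (Fin (n + 1) → F) ≃ ℙ F (Fin (n + 1) → F)) : Prop :=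
  ∀ (z : Fin (n + 1) → F) (hz : z ≠ 0),
    ∃ hU : U.mulVec z ≠ 0, p (.mk F z hz) = .mk F (U.mulVec z) hU

end ProjectiveSpace

/-! ### Parametrizations -/

/-- The image points of a tuple of forms, at the points where the forms do not all vanish. -/
def imagePoints {F : Type*} [Field F] {X : Dom} {n : ℕ}
    (p : Fin (n + 1) → MvPolynomial X.Var F) : Set (ℙ F (Fin (n + 1) → F)) :=
  {P | ∃ a : X.Var → F, X.IsPoint a ∧
    ∃ ha : (fun i => eval a (p i)) ≠ 0, P = .mk F (fun i => eval a (p i)) ha}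

/-- A rational map `f : X ⇢ img f ⊆ ℙⁿ`, where `X` is `ℙ²` or `ℙ¹ × ℙ¹`, given by forms of
the same (bi)degree whose greatest common divisor is constant, such that `img f` (the Zariski
closure of the image) is not contained in a hyperplane. Here `n` is the embedding dimension. -/
structure Param (F : Type*) [Field F] (X : Dom) (n : ℕ) where
  /-- the components -/
  comp : Fin (n + 1) → MvPolynomial X.Var F
  /-- the component degree -/
  cdeg : X.Deg
  homog : ∀ i, comp i ∈ X.forms F cdeg
  gcd_const : ∀ q, (∀ i, q ∣ comp i) → IsUnit q
  nondeg : ∀ a : Fin (n + 1) → F, a ≠ 0 → ¬ zariskiClosure (imagePoints comp) ⊆ hyperplane a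

namespace Param

variable {F : Type*} [Field F] {X Y : Dom} {n : ℕ}

/-- The Zariski closure of the image. -/
def img (f : Param F X n) : Set (ℙ F (Fin (n + 1) → F)) :=
  zariskiClosure (imagePoints f.comp)

/-- The associated vector space, spanned by the components. -/
noncomputable def assocSpace (f : Param F X n) : Submodule F (MvPolynomial X.Var F) :=
  Submodule.span F (Set.range f.comp)

/-- `f` is birational onto its image: there is a rational map `s : img f ⇢ X`, given on each
factor of `X` by forms of the same degree that do not all vanish on `img f`, such that
`s ∘ f` and `f ∘ s` are the identities. Since `f` is dominant onto `img f`, a form on `ℙⁿ` vanishes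
on `img f` if and only if its pullback along `f` is zero. -/
def IsBirational (f : Param F X n) : Prop :=
  ∃ (s : X.Var → MvPolynomial (Fin (n + 1)) F) (e : X.Factor → ℕ),
    (∀ x, (s x).IsHomogeneous (e (X.factor x))) ∧
    (∀ b, ∃ x, X.factor x = b ∧ aeval f.comp (s x) ≠ 0) ∧
    (∀ x x', X.factor x = X.factor x' →
      aeval f.comp (s x) * MvPolynomial.X x' = aeval f.comp (s x') * MvPolynomial.X x) ∧
    (∃ i, aeval f.comp (aeval s (f.comp i)) ≠ 0) ∧
    (∀ i j, aeval f.comp (aeval s (f.comp i)) * f.comp j =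
      aeval f.comp (aeval s (f.comp j)) * f.comp i)

end Param

/-! ### Birational maps between the domains -/

/-- A representative of a rational map `X ⇢ Y`: for each factor of `Y` a tuple of forms of the
same (bi)degree that are not all zero. -/
structure RatMap (F : Type*) [Field F] (X Y : Dom) where
  coord : Y.Var → MvPolynomial X.Var F
  deg : Y.Factor → X.Deg
  homog : ∀ y, coord y ∈ X.forms F (deg (Y.factor y))
  nonzero : ∀ b, ∃ y, Y.factor y = b ∧ coord y ≠ 0

/-- The composition `s ∘ r` is defined and is the identity of `X` as a rational map. -/
def RatMap.IsLeftInverse {F : Type*} [Field F] {X Y : Dom}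
    (s : RatMap F Y X) (r : RatMap F X Y) : Prop :=
  (∀ b, ∃ x, X.factor x = b ∧ aeval r.coord (s.coord x) ≠ 0) ∧
  ∀ x x', X.factor x = X.factor x' →
    aeval r.coord (s.coord x) * MvPolynomial.X x' = aeval r.coord (s.coord x') * MvPolynomial.X x

/-- (Representatives of) birational maps `X ⇢ Y`. -/
structure BirMap (F : Type*) [Field F] (X Y : Dom) extends RatMap F X Y where
  birational : ∃ s : RatMap F Y X, s.IsLeftInverse toRatMap ∧ toRatMap.IsLeftInverse s

/-- Two representatives define the same rational map. -/
def BirMap.Eqv {F : Type*} [Field F] {X Y : Dom} (r s : BirMap F X Y) : Prop :=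
  ∀ y y', Y.factor y = Y.factor y' → r.coord y * s.coord y' = r.coord y' * s.coord y

/-! ### The composition of a parametrization with a reparametrization -/

section Composition

variable {F : Type*} [Field F] {X Y : Dom} {n : ℕ}

/-- Auxiliary homomorphism that records the weight of each monomial in an extra variable. -/
noncomputable def weightHom {σ : Type*} (w : σ → ℕ) :
    MvPolynomial σ F →ₐ[F] Polynomial (MvPolynomial σ F) :=
  aeval fun x => Polynomial.monomial (w x) (MvPolynomial.X x)

theorem weightHom_monomial {σ : Type*} (w : σ → ℕ) (s : σ →₀ ℕ) (c : F) :
    weightHom w (monomial s c) = Polynomial.monomial (Finsupp.weight w s) (monomial s c) := by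
  induction s using Finsupp.induction with
  | zero => simp [weightHom, Polynomial.algebraMap_apply, algebraMap_eq,
      ← C_apply]
  | single_add i k s _ _ ih =>
    have h1 : (monomial (Finsupp.single i k + s) c : MvPolynomial σ F) =
        MvPolynomial.X i ^ k * monomial s c := by
      rw [X_pow_eq_monomial, monomial_mul, one_mul]
    rw [h1, map_mul, ih, map_pow, map_add]
    simp [weightHom, Finsupp.weight_single, Polynomial.monomial_pow,
      Polynomial.monomial_mul_monomial, mul_comm]

theorem weightHom_coeff {σ : Type*} (w : σ → ℕ) (p : MvPolynomial σ F) (k : ℕ) :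
    (weightHom w p).coeff k = weightedHomogeneousComponent w k p := by
  induction p using MvPolynomial.induction_on' with
  | monomial s c =>
    rw [weightHom_monomial, Polynomial.coeff_monomial]
    ext d
    rw [coeff_weightedHomogeneousComponent]
    by_cases hd : s = d
    · subst hd
      split_ifs <;> simp
    · have h0 : coeff d (monomial s c) = 0 := by
        classical rw [coeff_monomial, if_neg hd]
      by_cases hk : Finsupp.weight w s = k <;> simp [hk, h0]
  | add p q hp hq => simp [hp, hq]

/-- A factor of a weighted homogeneous polynomial is weighted homogeneous. -/
theorem isWeightedHomogeneous_right_of_mul {σ : Type*} (w : σ → ℕ) {p q : MvPolynomial σ F}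
    {m : ℕ} (h : IsWeightedHomogeneous w (p * q) m) (hpq : p * q ≠ 0) :
    ∃ k, IsWeightedHomogeneous w q k := by
  have hinj : ∀ u : MvPolynomial σ F, weightHom w u = 0 → u = 0 := by
    intro u hu
    rw [← sum_weightedHomogeneousComponent w u]
    simp [finsum_eq_zero_of_forall_eq_zero, ← weightHom_coeff, hu]
  have hP : weightHom w p ≠ 0 := fun h0 => left_ne_zero_of_mul hpq (hinj _ h0)
  have hQ : weightHom w q ≠ 0 := fun h0 => right_ne_zero_of_mul hpq (hinj _ h0)
  have hmon : weightHom w p * weightHom w q = Polynomial.monomial m (p * q) := by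
    rw [← map_mul]
    ext1 k
    rw [weightHom_coeff, Polynomial.coeff_monomial]
    split_ifs with hk
    · subst hk
      exact h.weightedHomogeneousComponent_same
    · exact h.weightedHomogeneousComponent_ne _ (Ne.symm hk)
  have h1 := Polynomial.natDegree_mul hP hQ
  have h2 := Polynomial.natTrailingDegree_mul hP hQ
  rw [hmon, Polynomial.natDegree_monomial_eq _ hpq] at h1
  rw [hmon, Polynomial.natTrailingDegree_monomial hpq] at h2
  have h3 := Polynomial.natTrailingDegree_le_natDegree (weightHom w p)
  have h4 := Polynomial.natTrailingDegree_le_natDegree (weightHom w q)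
  refine ⟨(weightHom w q).natDegree, fun d hd => ?_⟩
  have hc : (weightHom w q).coeff (Finsupp.weight w d) ≠ 0 := by
    rw [weightHom_coeff]
    intro h0
    have := congrArg (coeff d) h0
    rw [coeff_weightedHomogeneousComponent] at this
    simp at this
    exact hd this
  have h5 := Polynomial.le_natDegree_of_ne_zero hc
  have h6 := Polynomial.natTrailingDegree_le_of_ne_zero hc
  omega

theorem Dom.mem_forms_iff (X : Dom) (p : MvPolynomial X.Var F) (d : X.Deg) :
    p ∈ X.forms F d ↔ ∀ b, IsWeightedHomogeneous (fun x => X.weight x b) p (d b) := by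
  have key : ∀ (s : X.Var →₀ ℕ) (b : X.Factor),
      Finsupp.weight X.weight s b = Finsupp.weight (fun x => X.weight x b) s := by
    intro s b
    simp [Finsupp.weight_apply, Finsupp.sum, Finset.sum_apply]
  constructor
  · intro h b s hs
    rw [← key, h hs]
  · intro h s hs
    funext b
    rw [key, h b hs]

theorem Dom.forms_right_of_mul (X : Dom) {p q : MvPolynomial X.Var F} {d : X.Deg}
    (h : p * q ∈ X.forms F d) (hpq : p * q ≠ 0) : ∃ e, q ∈ X.forms F e := by
  have := fun b => isWeightedHomogeneous_right_of_mul _ ((X.mem_forms_iff _ _).1 h b) hpq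
  choose e he using this
  exact ⟨e, (X.mem_forms_iff _ _).2 he⟩

/-- Scaling the homogeneous coordinates of each factor. -/
theorem Dom.aeval_smul_forms (X : Dom) {q : MvPolynomial X.Var F} {d : X.Deg}
    (hq : q ∈ X.forms F d) {S : Type*} [CommRing S] [Algebra F S]
    (c : X.Factor → S) (z : X.Var → S) :
    aeval (fun x => c (X.factor x) * z x) q = (∏ b, c b ^ d b) * aeval z q := by
  rw [aeval_def, aeval_def, eval₂_eq, eval₂_eq, Finset.mul_sum]
  refine Finset.sum_congr rfl fun s hs => ?_
  have hd : Finsupp.weight X.weight s = d := hq (mem_support_iff.1 hs)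
  have h1 : ∏ b, c b ^ d b = ∏ i ∈ s.support, c (X.factor i) ^ s i := by
    have : ∀ b, d b = ∑ i ∈ s.support, if X.factor i = b then s i else 0 := by
      intro b
      rw [← hd, Finsupp.weight_apply, Finsupp.sum, Finset.sum_apply]
      refine Finset.sum_congr rfl fun i _ => ?_
      by_cases h : X.factor i = b
      · subst h; simp [Dom.weight]
      · simp [Dom.weight, h, Ne.symm h]
    calc ∏ b, c b ^ d b
        = ∏ b, ∏ i ∈ s.support, c b ^ (if X.factor i = b then s i else 0) := by
          refine Finset.prod_congr rfl fun b _ => ?_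
          rw [this b, Finset.prod_pow_eq_pow_sum]
      _ = ∏ i ∈ s.support, c (X.factor i) ^ s i := by
          rw [Finset.prod_comm]
          refine Finset.prod_congr rfl fun i _ => ?_
          rw [Finset.prod_eq_single (X.factor i)]
          · simp
          · intro b _ hb
            simp [Ne.symm hb]
          · simp
  rw [h1]
  simp only [mul_pow, Finset.prod_mul_distrib]
  ring

/-- Substituting a rational map into a form gives a form. -/
theorem RatMap.aeval_mem_forms (r : RatMap F X Y) {q : MvPolynomial Y.Var F} {d : Y.Deg}
    (hq : q ∈ Y.forms F d) :
    aeval r.coord q ∈ X.forms F (fun a => ∑ b, d b * r.deg b a) := by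
  rw [aeval_def, eval₂_eq]
  refine Submodule.sum_mem _ fun s hs => ?_
  have hd : Finsupp.weight Y.weight s = d := hq (mem_support_iff.1 hs)
  have hdeg : (fun a => ∑ b, d b * r.deg b a) =
      ∑ i ∈ s.support, s i • r.deg (Y.factor i) := by
    funext a
    simp only [← hd, Finsupp.weight_apply, Finsupp.sum, Finset.sum_apply, Finset.sum_mul,
      Pi.smul_apply, smul_eq_mul]
    rw [Finset.sum_comm]
    refine Finset.sum_congr rfl fun i _ => ?_
    rw [Finset.sum_eq_single (Y.factor i)]
    · simp [Dom.weight]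
    · intro b _ hb
      simp [Dom.weight, hb]
    · simp
  have hprod : IsWeightedHomogeneous X.weight (∏ i ∈ s.support, r.coord i ^ s i)
      (∑ i ∈ s.support, s i • r.deg (Y.factor i)) :=
    IsWeightedHomogeneous.prod _ _ _ fun i _ => IsWeightedHomogeneous.pow (r.homog i) _
  rw [hdeg]
  exact hprod.C_mul _

/-- A birational map is dominant. -/
theorem BirMap.eq_zero_of_aeval (r : BirMap F X Y) {q : MvPolynomial Y.Var F} {d : Y.Deg}
    (hq : q ∈ Y.forms F d) (h0 : aeval r.coord q = 0) : q = 0 := by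
  obtain ⟨s, -, hs1, hs2⟩ := r.birational
  choose y hy hne using hs1
  set R : Y.Var → MvPolynomial Y.Var F := fun z => aeval s.coord (r.coord z) with hR
  have hRq : aeval R q = 0 := by
    have := congrArg (aeval s.coord) h0
    rw [map_zero] at this
    rw [← this, hR, ← comp_aeval]
    rfl
  have e1 := Y.aeval_smul_forms hq (fun b => MvPolynomial.X (y b) (R := F)) R
  have e2 := Y.aeval_smul_forms hq (fun b => R (y b)) (fun z => MvPolynomial.X z (R := F))
  have e3 : (fun z => MvPolynomial.X (y (Y.factor z)) * R z) =
      fun z => R (y (Y.factor z)) * MvPolynomial.X z := by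
    funext z
    rw [mul_comm]
    exact hs2 z (y (Y.factor z)) (hy _).symm
  rw [e3, e2, hRq, mul_zero, aeval_X_left_apply] at e1
  refine (mul_eq_zero.1 e1).resolve_left ?_
  exact Finset.prod_ne_zero_iff.2 fun b _ => pow_ne_zero _ (hne b)

/-- Any finite tuple of polynomials is a common multiple of a tuple without common divisors. -/
theorem exists_reduced {σ : Type*} (p : Fin (n + 1) → MvPolynomial σ F) :
    ∃ (q : MvPolynomial σ F) (h : Fin (n + 1) → MvPolynomial σ F),
      (∀ i, p i = q * h i) ∧ ∀ u, (∀ i, u ∣ h i) → IsUnit u := by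
  classical
  let _ : StrongNormalizationMonoid (MvPolynomial σ F) :=
    UniqueFactorizationMonoid.strongNormalizationMonoid
  let _ : NormalizedGCDMonoid (MvPolynomial σ F) :=
    UniqueFactorizationMonoid.toNormalizedGCDMonoid _
  obtain ⟨h, h1, h2⟩ := Finset.extract_gcd (s := Finset.univ) p ⟨0, Finset.mem_univ _⟩
  refine ⟨_, h, fun i => h1 i (Finset.mem_univ i), fun u hu => ?_⟩
  have : u ∣ Finset.univ.gcd h := Finset.dvd_gcd fun i _ => hu i
  rw [h2] at this
  exact isUnit_of_dvd_one this

/-- The image points lie on the hyperplane with coefficients `a` if and only if the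
corresponding linear combination of the components is zero. -/
theorem closure_subset_hyperplane_iff [Infinite F] (p : Fin (n + 1) → MvPolynomial X.Var F)
    (a : Fin (n + 1) → F) :
    zariskiClosure (imagePoints p) ⊆ hyperplane a ↔ ∑ i, C (a i) * p i = 0 := by
  have hlin : ∀ (z : Fin (n + 1) → F) (hz : z ≠ 0),
      ∑ i, a i * (Projectivization.mk F z hz).rep i = 0 ↔ ∑ i, a i * z i = 0 := by
    intro z hz
    obtain ⟨u, hu⟩ := Projectivization.exists_smul_eq_mk_rep F z hz
    have : ∑ i, a i * (Projectivization.mk F z hz).rep i = (u : F) * ∑ i, a i * z i := by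
      rw [← hu, Finset.mul_sum]
      refine Finset.sum_congr rfl fun i _ => ?_
      simp only [Pi.smul_apply, Units.smul_def, smul_eq_mul]
      ring
    rw [this, mul_eq_zero, or_iff_right u.ne_zero]
  constructor
  · intro h
    choose x hx using X.factor_surjective
    have hprod : (∑ i, C (a i) * p i) * ∏ x : X.Var, MvPolynomial.X x = 0 := by
      refine MvPolynomial.funext fun t => ?_
      rw [map_zero, map_mul]
      by_cases ht : X.IsPoint t
      · refine mul_eq_zero_of_left ?_ _
        simp only [map_sum, map_mul, eval_C]
        by_cases h0 : (fun i => eval t (p i)) = 0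
        · exact Finset.sum_eq_zero fun i _ => by rw [show eval t (p i) = 0 from congrFun h0 i,
            mul_zero]
        · refine (hlin _ h0).1 (h ?_)
          intro d q _ hS
          exact hS _ ⟨t, ht, h0, rfl⟩
      · refine mul_eq_zero_of_right _ ?_
        simp only [Dom.IsPoint, not_forall, not_exists, not_and, not_not] at ht
        obtain ⟨b, hb⟩ := ht
        rw [map_prod]
        exact Finset.prod_eq_zero (Finset.mem_univ (x b)) (by rw [eval_X, hb _ (hx b)])
    refine (mul_eq_zero.1 hprod).resolve_right ?_
    exact Finset.prod_ne_zero_iff.2 fun x _ => X_ne_zero x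
  · intro h P hP
    have := hP 1 (∑ i, C (a i) * MvPolynomial.X i) ?_ ?_
    · simpa [hyperplane] using this
    · exact IsHomogeneous.sum _ _ _ fun i _ => by
        simpa using (isHomogeneous_C _ (a i)).mul (isHomogeneous_X F i)
    · rintro Q ⟨t, -, h0, rfl⟩
      simp only [map_sum, map_mul, eval_C, eval_X]
      rw [hlin]
      simpa using congrArg (eval t) h

theorem exists_comp [IsAlgClosed F] (g : Param F Y n) (r : BirMap F X Y) :
    ∃ h : Param F X n, ∃ q : MvPolynomial X.Var F, q ≠ 0 ∧
      ∀ i, aeval r.coord (g.comp i) = q * h.comp i := by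
  have : Infinite F := IsAlgClosed.instInfinite
  obtain ⟨q, h, hq, hgcd⟩ := exists_reduced fun i => aeval r.coord (g.comp i)
  have hgne : ∃ i, g.comp i ≠ 0 := by
    by_contra! h0
    have := g.gcd_const 0 fun i => by simp [h0 i]
    simp at this
  obtain ⟨i₀, hi₀⟩ := hgne
  have hr₀ : aeval r.coord (g.comp i₀) ≠ 0 := fun h0 => hi₀ (r.eq_zero_of_aeval (g.homog i₀) h0)
  have hq0 : q ≠ 0 := by
    rintro rfl
    exact hr₀ (by rw [hq, zero_mul])
  set D : X.Deg := fun a => ∑ b, g.cdeg b * r.deg b a with hD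
  have hforms : ∀ i, q * h i ∈ X.forms F D := fun i => by
    rw [← hq]; exact r.toRatMap.aeval_mem_forms (g.homog i)
  obtain ⟨k, hk⟩ := X.forms_right_of_mul (p := h i₀) (q := q) (d := D)
    (by rw [mul_comm]; exact hforms i₀) (by rw [mul_comm, ← hq]; exact hr₀)
  have hdeg : ∀ i, h i ∈ X.forms F (D - k) := by
    intro i
    by_cases h0 : h i = 0
    · rw [h0]; exact Submodule.zero_mem _
    · obtain ⟨e, he⟩ := X.forms_right_of_mul (hforms i) (mul_ne_zero hq0 h0)
      have : k + e = D := IsWeightedHomogeneous.inj_right (mul_ne_zero hq0 h0)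
        (IsWeightedHomogeneous.mul hk he) (hforms i)
      rwa [← this, add_tsub_cancel_left]
  refine ⟨⟨h, D - k, hdeg, hgcd, fun a ha hsub => ?_⟩, q, hq0, hq⟩
  rw [closure_subset_hyperplane_iff] at hsub
  refine g.nondeg a ha ((closure_subset_hyperplane_iff _ _).2 ?_)
  refine r.eq_zero_of_aeval (d := g.cdeg)
    (Submodule.sum_mem _ fun i _ => by
      rw [← smul_eq_C_mul]; exact Submodule.smul_mem _ _ (g.homog i)) ?_
  rw [map_sum, ← mul_zero q, ← hsub, Finset.mul_sum]
  refine Finset.sum_congr rfl fun i _ => ?_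
  rw [map_mul, hq, algHom_C, algebraMap_eq]
  ring

/-- The composition `g ∘ r`, computed by substitution and by factoring out the greatest common
divisor of the resulting components. Its components are unique up to a common nonzero scalar. -/
noncomputable def Param.compBir [IsAlgClosed F] (g : Param F Y n) (r : BirMap F X Y) :
    Param F X n :=
  (exists_comp g r).choose

theorem Param.compBir_spec [IsAlgClosed F] (g : Param F Y n) (r : BirMap F X Y) :
    ∃ q : MvPolynomial X.Var F, q ≠ 0 ∧
      ∀ i, aeval r.coord (g.comp i) = q * (g.compBir r).comp i :=
  (exists_comp g r).choose_spec

end Composition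

/-! ### Base points, including the infinitely near ones -/

section BasePoints

variable {F : Type*} [Field F]

/-- The standard affine charts: choose in each factor the coordinate that is set to one. -/
def Dom.Chart : Dom → Type
  | .P2 => Fin 3
  | .P1P1 => Fin 2 → Fin 2

/-- The homogeneous coordinates expressed in the affine coordinates of a chart, which are
translated so that the point `a` of the chart becomes the origin. -/
noncomputable def Dom.localCoord : (X : Dom) → X.Chart → (Fin 2 → F) → X.Var →
    MvPolynomial (Fin 2) F
  | .P2 => fun c a => Fin.insertNth (α := fun _ => MvPolynomial (Fin 2) F) (c : Fin 3) 1
      fun k => C (a k) + MvPolynomial.X k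
  | .P1P1 => fun c a y =>
      if (y : Fin 2 × Fin 2).2 = (c : Fin 2 → Fin 2) (y : Fin 2 × Fin 2).1 then 1
      else C (a (y : Fin 2 × Fin 2).1) + MvPolynomial.X (y : Fin 2 × Fin 2).1

/-- The multiplicity at the origin of the curve with equation `v`, for `v ≠ 0`: the smallest
degree of a monomial that occurs in `v`. -/
noncomputable def originMult (v : MvPolynomial (Fin 2) F) : ℕ :=
  sInf {k | homogeneousComponent k v ≠ 0}

/-- The blowup of the origin, in coordinates of the blown up surface that are centered at a point
of the exceptional curve: `some t` is the tangent direction `x 1 = t * x 0`, in coordinates with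
`x 0 = u 0`, `x 1 = u 0 * (u 1 + t)`, and `none` is the direction `x 0 = 0`, in coordinates with
`x 0 = u 0 * u 1`, `x 1 = u 1`. -/
noncomputable def blowupCoord : Option F → Fin 2 → MvPolynomial (Fin 2) F
  | some t => ![MvPolynomial.X 0, MvPolynomial.X 0 * (MvPolynomial.X 1 + C t)]
  | none => ![MvPolynomial.X 0 * MvPolynomial.X 1, MvPolynomial.X 1]

/-- The coordinate whose zero set is the exceptional curve. -/
def exceptionalCoord : Option F → Fin 2
  | some _ => 0
  | none => 1

/-- The equation of the strict transform of the curve with equation `v`: the pullback along the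
blowup, divided by the equation of the exceptional curve to the power of the multiplicity. -/
noncomputable def strictTransform (t : Option F) (v : MvPolynomial (Fin 2) F) :
    MvPolynomial (Fin 2) F :=
  (aeval (blowupCoord t) v).divMonomial (Finsupp.single (exceptionalCoord t) (originMult v))

/-- The multiplicity at the point that is reached by successively blowing up, starting at the
origin, and passing each time to the point of the exceptional curve in the given direction. -/
noncomputable def infNearMult : List (Option F) → MvPolynomial (Fin 2) F → ℕ
  | [], v => originMult v
  | t :: ts, v => infNearMult ts (strictTransform t v)

/-- A simple or infinitely near point of the domain: the point with coordinates `pos` in an affine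
chart, followed by a finite sequence of points, each on the exceptional curve of the blowup of the
preceding point (the empty sequence is the simple point itself). A point that lies in several
charts is described once in each of these charts. -/
structure InfNearPoint (F : Type*) [Field F] (X : Dom) where
  chart : X.Chart
  pos : Fin 2 → F
  directions : List (Option F)

/-- The multiplicity at a simple or infinitely near point of the curve defined by the form `v`. -/
noncomputable def multAt {X : Dom} (q : InfNearPoint F X) (v : MvPolynomial X.Var F) : ℕ :=
  infNearMult q.directions (aeval (X.localCoord q.chart q.pos) v)

/-- A property holds for a general element of a finite-dimensional vector space of forms: it holds
on a nonempty Zariski-open subset. -/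
def HoldsGenerally {X : Dom} (V : Submodule F (MvPolynomial X.Var F))
    (P : MvPolynomial X.Var F → Prop) : Prop :=
  ∃ (k : ℕ) (b : Module.Basis (Fin k) F V) (Φ : MvPolynomial (Fin k) F), Φ ≠ 0 ∧
    ∀ v : V, eval (fun i => b.repr v i) Φ ≠ 0 → P v

/-- The base points of a parametrization, simple or infinitely near, with their multiplicities:
the pairs `(q, m)` such that a general element of the associated vector space has multiplicity
`m > 0` at `q`. -/
def Param.basePoints {X : Dom} {n : ℕ} (f : Param F X n) : Set (InfNearPoint F X × ℕ) :=
  {qm | 0 < qm.2 ∧ HoldsGenerally f.assocSpace fun v => multAt qm.1 v = qm.2}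

end BasePoints

/-! ### Projective isomorphisms, compatible reparametrizations, and coefficient matrices -/

section Main

variable {F : Type*} [Field F] {X Y : Dom} {n : ℕ}

/-- The set `𝒫(f, g)` of projective isomorphisms. -/
def projIsos (f : Param F X n) (g : Param F Y n) :
    Set (ℙ F (Fin (n + 1) → F) ≃ ℙ F (Fin (n + 1) → F)) :=
  {p | p ∈ projAut F n ∧ p '' f.img = g.img}

/-- The rational maps `p ∘ f` and `g ∘ r` are equal: they agree at all points where the given
representatives of both are defined. -/
def CompEq (p : ℙ F (Fin (n + 1) → F) ≃ ℙ F (Fin (n + 1) → F)) (f : Param F X n)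
    (g : Param F Y n) (r : BirMap F X Y) : Prop :=
  ∀ a : X.Var → F, X.IsPoint a → Y.IsPoint (fun y => eval a (r.coord y)) →
    ∀ (hf : (fun i => eval a (f.comp i)) ≠ 0)
      (hg : (fun i => eval (fun y => eval a (r.coord y)) (g.comp i)) ≠ 0),
      p (.mk F (fun i => eval a (f.comp i)) hf) =
        .mk F (fun i => eval (fun y => eval a (r.coord y)) (g.comp i)) hg

/-- The set `ℛ(f, g)` of compatible reparametrizations. -/
def compatibleReparams (f : Param F X n) (g : Param F Y n) : Set (BirMap F X Y) :=
  {r | ∃ p ∈ projIsos f g, CompEq p f g r}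

open Classical in
/-- The coefficient matrix of `h` with respect to the basis `v` of the forms of (bi)degree `d`:
the matrix `M` with `h i = ∑ j, M i j * v j`, if the component degree of `h` is `d`. -/
noncomputable def coeffMatrix {d : X.Deg} {ι : Type*} (v : Module.Basis ι F (X.forms F d))
    (h : Param F X n) : Matrix (Fin (n + 1)) ι F :=
  Matrix.of fun i j => if hi : h.comp i ∈ X.forms F d then v.repr ⟨h.comp i, hi⟩ j else 0

/-- The columns of `K` form a basis for the kernel of `M`. -/
def IsKernelMatrix {m ι κ : Type*} [Fintype ι] (M : Matrix m ι F) (K : Matrix ι κ F) : Prop :=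
  LinearIndependent F K.col ∧
    Submodule.span F (Set.range K.col) = LinearMap.ker M.mulVecLin

/-- The matrix `(Mᵀ | K)ᵀ`. -/
def augmented {m ι κ : Type*} (M : Matrix m ι F) (K : Matrix ι κ F) : Matrix (m ⊕ κ) ι F :=
  (Matrix.fromCols M.transpose K).transpose

/-- The index set `𝒥`: the indices `c` such that `g ∘ r c` has the same base points as `f` (with
the same multiplicities), the same component degree as `f`, and `M_{g ∘ r c} * ker M_f = 0`. -/
def indexSet [IsAlgClosed F] (f : Param F X n) (g : Param F Y n) {I : Type*}
    (r : I → BirMap F X Y) {ι κ : Type*} [Fintype ι] (v : Module.Basis ι F (X.forms F f.cdeg))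
    (K : Matrix ι κ F) : Set I :=
  {c | (g.compBir (r c)).basePoints = f.basePoints ∧
    (g.compBir (r c)).cdeg = f.cdeg ∧
    coeffMatrix v (g.compBir (r c)) * K = 0}

end Main

/-!
# Projective isomorphisms between rational surfaces via reparametrizations

A projective isomorphism `p` from `img f` to `img g` is projective linear, `p = χ_U`: a regular
self-map of `ℙⁿ` is given globally by forms without a common zero (`IsRegularMap.exists_forms`), and
since those of `p` and of `p⁻¹` compose to a multiple of the identity without zeros, they are
linear (`exists_isProjLinear_of_mem_projAut`).

Replacing `f` by `χ_U ∘ f` reduces to parametrizations `f` and `g` of the same image. A form on `ℙⁿ`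
vanishes on the image exactly if its pullback along either parametrization is zero
(`Param.img_eq_img_iff`), so identities between pullbacks may be transferred from `g` to `f`. In
this way the inverse of `g` composes with `f` to a birational map `r = g⁻¹ ∘ f` with `g ∘ r = f`
(`Param.exists_birMap`). It is compatible, hence represented by a member `r_c` of the family. The
tuples of `g ∘ r_c` and `χ_U ∘ f` are proportional and have no common divisor, so by unique
factorization they agree up to a scalar, which is absorbed into `U`
(`exists_comp_eq_of_mem_projIsos`). Then `M_{g ∘ r_c} = U * M_f`, which is the matrix equation, and
the conditions on `c` hold: both tuples span the same space, and base points depend on this span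
only.

Conversely, the matrix equation together with the equality of the component degrees says
`g ∘ r_c = χ_U ∘ f`, and `img (g ∘ r_c) = img g` because `r_c` is dominant (`Param.img_compBir`).
-/

/-! ### Proportional tuples -/

section Proportional

variable {F : Type*} [Field F] {n : ℕ}

theorem exists_ne_zero_of_gcd_const {σ : Type*} {h : Fin (n + 1) → MvPolynomial σ F}
    (hh : ∀ u, (∀ i, u ∣ h i) → IsUnit u) : ∃ i, h i ≠ 0 := by
  by_contra! h0
  simpa using hh 0 fun i => by simp [h0 i]

/-- A tuple that is proportional to a tuple without common divisors is a polynomial multiple of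
it. Here and below, proportionality is expressed by the vanishing of all `2 × 2` minors. -/
theorem exists_eq_mul_of_cross_mul_eq {σ : Type*} {h p : Fin (n + 1) → MvPolynomial σ F}
    (hh : ∀ u, (∀ i, u ∣ h i) → IsUnit u) (hp : ∀ i j, h i * p j = h j * p i) :
    ∃ q, ∀ i, p i = q * h i := by
  classical
  let _ : StrongNormalizationMonoid (MvPolynomial σ F) :=
    UniqueFactorizationMonoid.strongNormalizationMonoid
  let _ : StrongNormalizedGCDMonoid (MvPolynomial σ F) :=
    UniqueFactorizationMonoid.toStrongNormalizedGCDMonoid _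
  have hgcd : IsUnit (Finset.univ.gcd h) :=
    hh _ fun i => Finset.gcd_dvd (Finset.mem_univ i)
  obtain ⟨i₀, hi₀⟩ := exists_ne_zero_of_gcd_const hh
  have hdvd : h i₀ ∣ p i₀ := by
    have h1 : h i₀ ∣ Finset.univ.gcd fun j => h j * p i₀ :=
      Finset.dvd_gcd fun j _ => ⟨p j, (hp i₀ j).symm⟩
    rw [Finset.univ.gcd_mul_right (f := h)] at h1
    exact (normalize_associated _).dvd_iff_dvd_right.1 (hgcd.dvd_mul_left.1 h1)
  obtain ⟨q, hq⟩ := hdvd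
  refine ⟨q, fun i => mul_left_cancel₀ hi₀ ?_⟩
  rw [hp i₀ i, hq]
  ring

/-- Two proportional tuples without common divisors agree up to a nonzero scalar. -/
theorem exists_eq_C_mul_of_cross_mul_eq {σ : Type*} {h p : Fin (n + 1) → MvPolynomial σ F}
    (hh : ∀ u, (∀ i, u ∣ h i) → IsUnit u) (hp : ∀ u, (∀ i, u ∣ p i) → IsUnit u)
    (hc : ∀ i j, h i * p j = h j * p i) : ∃ c : F, c ≠ 0 ∧ ∀ i, p i = C c * h i := by
  obtain ⟨q, hq⟩ := exists_eq_mul_of_cross_mul_eq hh hc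
  have hu : IsUnit q := hp q fun i => ⟨h i, hq i⟩
  obtain ⟨c, hc, rfl⟩ := (MvPolynomial.isUnit_iff_eq_C_of_isReduced).1 hu
  exact ⟨c, hc.ne_zero, hq⟩

theorem exists_smul_of_cross_mul_eq {ι : Type*} {z w : ι → F} (hz : z ≠ 0) (hw : w ≠ 0)
    (h : ∀ i j, z i * w j = z j * w i) : ∃ a : F, a ≠ 0 ∧ a • w = z := by
  obtain ⟨i, hi⟩ := Function.ne_iff.1 hw
  obtain ⟨j, hj⟩ := Function.ne_iff.1 hz
  have hzi : z i ≠ 0 := by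
    intro h0
    have := h i j
    rw [h0, zero_mul] at this
    exact mul_ne_zero hj hi this.symm
  refine ⟨z i / w i, div_ne_zero hzi hi, funext fun k => ?_⟩
  have hi' : w i ≠ 0 := hi
  simp only [Pi.smul_apply, smul_eq_mul]
  rw [div_mul_eq_mul_div, h i k, mul_div_cancel_right₀ _ hi']

theorem mk_eq_mk_iff_cross_mul_eq {ι : Type*} {z w : ι → F} (hz : z ≠ 0) (hw : w ≠ 0) :
    Projectivization.mk F z hz = Projectivization.mk F w hw ↔
      ∀ i j, z i * w j = z j * w i := by
  rw [Projectivization.mk_eq_mk_iff']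
  constructor
  · rintro ⟨a, rfl⟩ i j
    simp only [Pi.smul_apply, smul_eq_mul]
    ring
  · intro h
    obtain ⟨a, -, ha⟩ := exists_smul_of_cross_mul_eq hz hw h
    exact ⟨a, ha⟩

end Proportional

/-! ### Homogeneous polynomials -/

section Homogeneous

variable {F : Type*} [Field F] {n : ℕ}

theorem aeval_mul_of_isHomogeneous {σ S : Type*} [CommRing S] [Algebra F S]
    {q : MvPolynomial σ F} {d : ℕ} (hq : q.IsHomogeneous d) (c : S) (z : σ → S) :
    aeval (fun i => c * z i) q = c ^ d * aeval z q := by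
  rw [aeval_def, aeval_def, eval₂_eq, eval₂_eq, Finset.mul_sum]
  refine Finset.sum_congr rfl fun s hs => ?_
  have hd : s.degree = d := by
    by_contra h
    exact mem_support_iff.1 hs (hq.coeff_eq_zero h)
  simp only [mul_pow, Finset.prod_mul_distrib, Finset.prod_pow_eq_pow_sum]
  rw [← hd, Finsupp.degree_apply]
  ring

theorem eval_smul_of_isHomogeneous {σ : Type*} {q : MvPolynomial σ F} {d : ℕ}
    (hq : q.IsHomogeneous d) (c : F) (z : σ → F) : eval (c • z) q = c ^ d * eval z q := by
  have := aeval_mul_of_isHomogeneous hq c z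
  rwa [aeval_eq_eval, aeval_eq_eval] at this

/-- The vanishing of a form at a point does not depend on the representative. -/
theorem eval_rep_mk_eq_zero_iff {ι : Type*} {q : MvPolynomial ι F} {d : ℕ}
    (hq : q.IsHomogeneous d) {z : ι → F} (hz : z ≠ 0) :
    eval (Projectivization.mk F z hz).rep q = 0 ↔ eval z q = 0 := by
  obtain ⟨u, hu⟩ := Projectivization.exists_smul_eq_mk_rep F z hz
  rw [← hu, Units.smul_def, eval_smul_of_isHomogeneous hq, mul_eq_zero,
    or_iff_right (pow_ne_zero _ u.ne_zero)]

theorem polynomial_eval_aeval {σ : Type*} (q : MvPolynomial σ F) (z : σ → Polynomial F) (t : F) :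
    (aeval z q).eval t = eval (fun i => (z i).eval t) q := by
  induction q using MvPolynomial.induction_on with
  | C a => simp
  | add p q hp hq => simp [hp, hq]
  | mul_X p i hp => simp [hp]

/-- A form of positive degree in at least two variables over an algebraically closed field has
a nontrivial zero. -/
theorem exists_eval_eq_zero_of_isHomogeneous [IsAlgClosed F] (hn : n ≠ 0)
    {q : MvPolynomial (Fin (n + 1)) F} {d : ℕ} (hq : q.IsHomogeneous d) (hd : d ≠ 0) :
    ∃ z : Fin (n + 1) → F, z ≠ 0 ∧ eval z q = 0 := by
  have : Infinite F := IsAlgClosed.instInfinite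
  by_contra! hne
  have h10 : (Fin.last n) ≠ 0 := by simpa [Fin.ext_iff] using hn
  -- the restrictions of the form to two affine charts of a coordinate line
  let Q : Polynomial F := aeval
    (fun i => if i = 0 then 1 else if i = Fin.last n then Polynomial.X else 0) q
  let P : Polynomial F := aeval
    (fun i => if i = 0 then Polynomial.X else if i = Fin.last n then 1 else 0) q
  have hQ : ∀ t, Q.eval t =
      eval (fun i => if i = 0 then 1 else if i = Fin.last n then t else 0) q := by
    intro t
    rw [polynomial_eval_aeval]
    congr 2
    funext i
    split_ifs <;> simp
  have hP : ∀ t, P.eval t =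
      eval (fun i => if i = 0 then t else if i = Fin.last n then 1 else 0) q := by
    intro t
    rw [polynomial_eval_aeval]
    congr 2
    funext i
    split_ifs <;> simp
  -- `Q` has no zeros, hence is a constant `c`; then `P = c * T ^ d` vanishes at `0`
  have hQc : Q.degree = 0 := by
    by_contra h
    obtain ⟨t, ht⟩ := IsAlgClosed.exists_root Q h
    rw [Polynomial.IsRoot, hQ] at ht
    exact hne _ (Function.ne_iff.2 ⟨0, by simp⟩) ht
  obtain ⟨c, hc⟩ : ∃ c, Q = Polynomial.C c := ⟨_, Polynomial.eq_C_of_degree_eq_zero hQc⟩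
  have hPc : P = Polynomial.C c * Polynomial.X ^ d := by
    refine Polynomial.eq_of_infinite_eval_eq _ _ ?_
    refine (Set.infinite_univ.sdiff (Set.finite_singleton (0 : F))).mono ?_
    rintro t ⟨-, ht⟩
    have ht0 : t ≠ 0 := ht
    have e : (fun i : Fin (n + 1) => if i = 0 then t else if i = Fin.last n then 1 else 0) =
        t • (fun i => if i = 0 then 1 else if i = Fin.last n then t⁻¹ else 0) := by
      funext i
      simp only [Pi.smul_apply, smul_eq_mul]
      split_ifs <;> simp [ht0]
    rw [Set.mem_ofPred_eq, hP, e, eval_smul_of_isHomogeneous hq, ← hQ, hc,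
      Polynomial.eval_C, Polynomial.eval_mul, Polynomial.eval_C, Polynomial.eval_pow,
      Polynomial.eval_X, mul_comm]
  refine hne (fun i => if i = 0 then 0 else if i = Fin.last n then 1 else 0)
    (Function.ne_iff.2 ⟨Fin.last n, by simp [h10]⟩) ?_
  rw [← hP, hPc]
  simp [hd]

theorem exists_coeff_of_isHomogeneous_one {q : MvPolynomial (Fin (n + 1)) F}
    (hq : q.IsHomogeneous 1) : ∃ a : Fin (n + 1) → F, ∀ z, eval z q = ∑ j, a j * z j := by
  have hq' : q ∈ homogeneousSubmodule (Fin (n + 1)) F 1 := hq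
  rw [homogeneousSubmodule_one_eq_span_X, Submodule.mem_span_range_iff_exists_fun] at hq'
  obtain ⟨a, rfl⟩ := hq'
  exact ⟨a, fun z => by simp [smul_eval]⟩

end Homogeneous

/-! ### Automorphisms of projective space -/

section Automorphisms

variable {F : Type*} [Field F] {n : ℕ}

/-- A regular self-map of `ℙⁿ` is given globally by forms without a common zero: two local
representations are proportional, so each of them is a multiple of a representation without common
divisors. -/
theorem IsRegularMap.exists_forms [Infinite F]
    {p : ℙ F (Fin (n + 1) → F) → ℙ F (Fin (n + 1) → F)} (hp : IsRegularMap p) :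
    ∃ (d : ℕ) (φ : Fin (n + 1) → MvPolynomial (Fin (n + 1)) F), (∀ i, (φ i).IsHomogeneous d) ∧
      ∀ (z : Fin (n + 1) → F) (hz : z ≠ 0), ∃ hφ : (fun i => eval z (φ i)) ≠ 0,
        p (.mk F z hz) = .mk F (fun i => eval z (φ i)) hφ := by
  obtain ⟨d, ψ, hψ, hne, hpψ⟩ := hp (.mk F (fun _ => 1) (Function.ne_iff.2 ⟨0, one_ne_zero⟩))
  obtain ⟨q, φ, hφ, hgcd⟩ := exists_reduced ψ
  obtain ⟨i₀, hi₀⟩ : ∃ i, ψ i ≠ 0 := by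
    obtain ⟨i, hi⟩ := Function.ne_iff.1 hne
    exact ⟨i, fun h0 => hi (by simp [h0])⟩
  have hq : q ≠ 0 := fun h0 => hi₀ (by rw [hφ, h0, zero_mul])
  -- the common degree of the reduced forms
  have hhom : ∃ k, ∀ i, (φ i).IsHomogeneous k := by
    obtain ⟨k, hk⟩ := isWeightedHomogeneous_right_of_mul (p := φ i₀) (q := q) 1 (m := d)
      (by rw [mul_comm, ← hφ]; exact hψ i₀) (by rwa [mul_comm, ← hφ])
    refine ⟨d - k, fun i => ?_⟩
    by_cases h0 : φ i = 0
    · rw [h0]; exact isHomogeneous_zero _ _ _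
    · obtain ⟨e, he⟩ := isWeightedHomogeneous_right_of_mul (p := q) (q := φ i) 1 (m := d)
        (by rw [← hφ]; exact hψ i) (mul_ne_zero hq h0)
      have : k + e = d := IsWeightedHomogeneous.inj_right (mul_ne_zero hq h0)
        (IsWeightedHomogeneous.mul hk he) (by rw [← hφ]; exact hψ i)
      rwa [← this, add_tsub_cancel_left]
  obtain ⟨k, hk⟩ := hhom
  have key : ∀ (z : Fin (n + 1) → F) (hz : z ≠ 0), ∃ hφ : (fun i => eval z (φ i)) ≠ 0,
      p (.mk F z hz) = .mk F (fun i => eval z (φ i)) hφ := by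
    intro z hz
    obtain ⟨e, χ, hχ, hχz, hpχ⟩ := hp (.mk F z hz)
    have hχz_mk : (fun i => eval z (χ i)) ≠ 0 := by
      obtain ⟨i, hi⟩ := Function.ne_iff.1 hχz
      exact Function.ne_iff.2 ⟨i, fun h0 => hi ((eval_rep_mk_eq_zero_iff (hχ i) hz).2 h0)⟩
    have hcross : ∀ i j, ψ i * χ j = ψ j * χ i := by
      intro i j
      -- the factor `X 0` takes care of the origin, which is not a point of projective space
      refine mul_right_cancel₀ (X_ne_zero (0 : Fin (n + 1))) (MvPolynomial.funext fun w => ?_)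
      simp only [map_mul, eval_X]
      by_cases hw : w = 0
      · simp [hw]
      congr 1
      by_cases h1 : (fun i => eval w (ψ i)) = 0
      · rw [show eval w (ψ i) = 0 from congrFun h1 i, show eval w (ψ j) = 0 from congrFun h1 j,
          zero_mul, zero_mul]
      by_cases h2 : (fun i => eval w (χ i)) = 0
      · rw [show eval w (χ i) = 0 from congrFun h2 i, show eval w (χ j) = 0 from congrFun h2 j,
          mul_zero, mul_zero]
      exact (mk_eq_mk_iff_cross_mul_eq h1 h2).1 ((hpψ w hw h1).symm.trans (hpχ w hw h2)) i j
    obtain ⟨u, hu⟩ := exists_eq_mul_of_cross_mul_eq hgcd (p := χ) fun i j => by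
      have := hcross i j
      rw [hφ, hφ, mul_assoc, mul_assoc] at this
      exact mul_left_cancel₀ hq this
    have hφz : (fun i => eval z (φ i)) ≠ 0 := by
      obtain ⟨i, hi⟩ := Function.ne_iff.1 hχz_mk
      refine Function.ne_iff.2 ⟨i, fun h0 => hi ?_⟩
      have h0 : eval z (φ i) = 0 := h0
      simp [hu, h0]
    refine ⟨hφz, (hpχ z hz hχz_mk).trans ((mk_eq_mk_iff_cross_mul_eq _ _).2 fun i j => ?_)⟩
    rw [hu, hu, map_mul, map_mul]
    ring
  exact ⟨k, φ, hk, key⟩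

/-- A biregular automorphism of `ℙⁿ` is projective linear. If `p` and its inverse are given by
forms `φ` and `ψ` without common zeros, then `ψ ∘ φ` is a multiple `h` of the identity, where the
form `h` has no zeros and is therefore constant; comparing degrees, `φ` is linear. -/
theorem exists_isProjLinear_of_mem_projAut [IsAlgClosed F]
    {p : ℙ F (Fin (n + 1) → F) ≃ ℙ F (Fin (n + 1) → F)} (hp : p ∈ projAut F n) :
    ∃ U, IsProjLinear U p := by
  have : Infinite F := IsAlgClosed.instInfinite
  obtain ⟨d, φ, hφ, hpφ⟩ := hp.1.exists_forms
  obtain ⟨e, ψ, hψ, hpψ⟩ := hp.2.exists_forms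
  -- on the point `ℙ⁰`, forms of any degree give the identity, so no degree comparison is possible
  rcases eq_or_ne n 0 with rfl | hn
  · refine ⟨1, fun z hz => ⟨by rwa [Matrix.one_mulVec], ?_⟩⟩
    obtain ⟨h1, h2⟩ := hpφ z hz
    rw [h2, mk_eq_mk_iff_cross_mul_eq]
    intro i j
    rw [Subsingleton.elim (α := Fin 1) i j]
  -- the composition `ψ ∘ φ` fixes every point
  have hcomp : ∀ (z : Fin (n + 1) → F), z ≠ 0 →
      (fun i => eval z (aeval φ (ψ i))) ≠ 0 ∧
      ∀ i j, z i * eval z (aeval φ (ψ j)) = z j * eval z (aeval φ (ψ i)) := by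
    intro z hz
    obtain ⟨h1, h2⟩ := hpφ z hz
    obtain ⟨h3, h4⟩ := hpψ _ h1
    have e : ∀ i, eval z (aeval φ (ψ i)) = eval (fun i => eval z (φ i)) (ψ i) := by
      intro i
      rw [← aeval_eq_eval, ← aeval_eq_eval, ← AlgHom.comp_apply, comp_aeval]
    simp only [e]
    refine ⟨h3, (mk_eq_mk_iff_cross_mul_eq hz h3).1 ?_⟩
    rw [← h4, ← h2, Equiv.symm_apply_apply]
  have h01 : (0 : Fin (n + 1)) ≠ Fin.last n := by simpa [Fin.ext_iff] using hn.symm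
  obtain ⟨h, hh⟩ := exists_eq_mul_of_cross_mul_eq
    (h := fun i : Fin (n + 1) => (X i : MvPolynomial (Fin (n + 1)) F))
    (p := fun i => aeval φ (ψ i))
    (by
      intro u hu
      obtain ⟨v, hv⟩ := hu 0
      rcases (X_prime (R := F) (i := (0 : Fin (n + 1)))).irreducible.isUnit_or_isUnit hv with h | h
      · exact h
      · have h0 : X (R := F) (0 : Fin (n + 1)) ∣ X (Fin.last n) := by
          rw [hv]
          exact h.mul_right_dvd.2 (hu _)
        exact absurd (X_dvd_X.1 h0) h01)
    (by
      intro i j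
      refine MvPolynomial.funext fun z => ?_
      simp only [map_mul, eval_X]
      by_cases hz : z = 0
      · simp [hz]
      · exact (hcomp z hz).2 i j)
  have hh0 : h ≠ 0 := by
    rintro rfl
    exact (hcomp (fun _ => 1) (Function.ne_iff.2 ⟨0, one_ne_zero⟩)).1 (by
      funext i
      rw [hh]
      simp)
  have hdeg : (h * X 0).IsHomogeneous (d * e) := by
    rw [← hh]
    exact (hψ 0).aeval φ hφ
  obtain ⟨k, hk⟩ := isWeightedHomogeneous_right_of_mul (p := X 0) (q := h) 1
    (by rw [mul_comm]; exact hdeg) (mul_ne_zero (X_ne_zero _) hh0)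
  have hk0 : k = 0 := by
    by_contra hk0
    obtain ⟨z, hz, hz0⟩ := exists_eval_eq_zero_of_isHomogeneous hn hk hk0
    exact (hcomp z hz).1 (by
      funext i
      rw [hh, map_mul, hz0, zero_mul]
      rfl)
  have hd : d = 1 := by
    have : k + 1 = d * e := IsHomogeneous.inj_right
      (IsHomogeneous.mul (φ := h) hk (isHomogeneous_X F 0)) hdeg (mul_ne_zero hh0 (X_ne_zero _))
    rw [hk0] at this
    exact Nat.eq_one_of_mul_eq_one_right this.symm
  subst hd
  choose a ha using fun i => exists_coeff_of_isHomogeneous_one (hφ i)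
  refine ⟨Matrix.of a, fun z hz => ?_⟩
  have : (Matrix.of a).mulVec z = fun i => eval z (φ i) := by
    funext i
    rw [ha]
    rfl
  rw [this]
  exact hpφ z hz

theorem IsProjLinear.isUnit {U : Matrix (Fin (n + 1)) (Fin (n + 1)) F}
    {p : ℙ F (Fin (n + 1) → F) ≃ ℙ F (Fin (n + 1) → F)} (hU : IsProjLinear U p) : IsUnit U := by
  rw [← Matrix.mulVec_injective_iff_isUnit]
  refine (injective_iff_map_eq_zero U.mulVecLin).2 fun z hz => ?_
  by_contra h0
  exact (hU z h0).1 hz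

theorem IsProjLinear.smul {U : Matrix (Fin (n + 1)) (Fin (n + 1)) F}
    {p : ℙ F (Fin (n + 1) → F) ≃ ℙ F (Fin (n + 1) → F)} (hU : IsProjLinear U p) {c : F}
    (hc : c ≠ 0) : IsProjLinear (c • U) p := by
  intro z hz
  obtain ⟨h1, h2⟩ := hU z hz
  have h3 : (c • U).mulVec z ≠ 0 := by
    rw [Matrix.smul_mulVec]
    exact smul_ne_zero hc h1
  refine ⟨h3, h2.trans ((mk_eq_mk_iff_cross_mul_eq _ _).2 fun i j => ?_)⟩
  simp only [Matrix.smul_mulVec, Pi.smul_apply, smul_eq_mul]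
  ring

end Automorphisms

/-! ### Linear substitutions -/

section LinearTransformation

variable {F : Type*} [Field F] {n : ℕ}

theorem inv_map_mulVec_map_mulVec {σ : Type*} {U : Matrix (Fin (n + 1)) (Fin (n + 1)) F}
    (hU : IsUnit U) (p : Fin (n + 1) → MvPolynomial σ F) :
    (U⁻¹.map C).mulVec ((U.map C).mulVec p) = p := by
  rw [Matrix.mulVec_mulVec, ← Matrix.map_mul,
    Matrix.nonsing_inv_mul _ ((Matrix.isUnit_iff_isUnit_det _).1 hU), Matrix.map_one _ C_0 C_1,
    Matrix.one_mulVec]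

theorem map_C_mulVec_apply {σ : Type*} (U : Matrix (Fin (n + 1)) (Fin (n + 1)) F)
    (p : Fin (n + 1) → MvPolynomial σ F) (i : Fin (n + 1)) :
    (U.map C).mulVec p i = ∑ j, U i j • p j := by
  simp [Matrix.mulVec, dotProduct, smul_eq_C_mul]

theorem algHom_map_mulVec {σ τ : Type*} (φ : MvPolynomial σ F →ₐ[F] MvPolynomial τ F)
    (U : Matrix (Fin (n + 1)) (Fin (n + 1)) F) (p : Fin (n + 1) → MvPolynomial σ F)
    (i : Fin (n + 1)) :
    φ ((U.map C).mulVec p i) = (U.map C).mulVec (fun j => φ (p j)) i := by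
  simp [Matrix.mulVec, dotProduct, algHom_C, algebraMap_eq]

theorem eval_map_mulVec {σ : Type*} (U : Matrix (Fin (n + 1)) (Fin (n + 1)) F)
    (p : Fin (n + 1) → MvPolynomial σ F) (a : σ → F) (i : Fin (n + 1)) :
    eval a ((U.map C).mulVec p i) = U.mulVec (fun j => eval a (p j)) i := by
  simp [Matrix.mulVec, dotProduct]

theorem isHomogeneous_map_mulVec_X (U : Matrix (Fin (n + 1)) (Fin (n + 1)) F)
    (i : Fin (n + 1)) : ((U.map C).mulVec (X (R := F)) i).IsHomogeneous 1 :=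
  IsHomogeneous.sum _ _ _ fun _ _ => isHomogeneous_C_mul_X _ _

/-- Substituting linear forms for the variables of a form preserves its degree. -/
theorem isHomogeneous_aeval_map_mulVec_X (U : Matrix (Fin (n + 1)) (Fin (n + 1)) F)
    {q : MvPolynomial (Fin (n + 1)) F} {d : ℕ} (hq : q.IsHomogeneous d) :
    (aeval ((U.map C).mulVec (X (R := F))) q).IsHomogeneous d := by
  simpa using hq.aeval _ (isHomogeneous_map_mulVec_X U)

theorem aeval_aeval_map_mulVec_X {σ : Type*} (U : Matrix (Fin (n + 1)) (Fin (n + 1)) F)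
    (p : Fin (n + 1) → MvPolynomial σ F) (q : MvPolynomial (Fin (n + 1)) F) :
    aeval p (aeval ((U.map C).mulVec (X (R := F))) q) = aeval ((U.map C).mulVec p) q := by
  rw [← AlgHom.comp_apply, comp_aeval]
  congr 2
  funext i
  rw [algHom_map_mulVec]
  simp

theorem eval_aeval_map_mulVec_X (U : Matrix (Fin (n + 1)) (Fin (n + 1)) F)
    (z : Fin (n + 1) → F) (q : MvPolynomial (Fin (n + 1)) F) :
    eval z (aeval ((U.map C).mulVec (X (R := F))) q) = eval (U.mulVec z) q := by
  rw [← aeval_eq_eval, ← aeval_eq_eval, ← AlgHom.comp_apply, comp_aeval]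
  congr 2
  funext i
  rw [aeval_eq_eval, eval_map_mulVec]
  simp

theorem cross_mul_eq_map_mulVec {σ : Type*} (U : Matrix (Fin (n + 1)) (Fin (n + 1)) F)
    {p q : Fin (n + 1) → MvPolynomial σ F} (h : ∀ i j, p i * q j = p j * q i)
    (i j : Fin (n + 1)) :
    (U.map C).mulVec p i * (U.map C).mulVec q j =
      (U.map C).mulVec p j * (U.map C).mulVec q i := by
  simp only [Matrix.mulVec, dotProduct, Matrix.map_apply, Finset.sum_mul_sum]
  rw [Finset.sum_comm]
  refine Finset.sum_congr rfl fun k _ => Finset.sum_congr rfl fun l _ => ?_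
  linear_combination C (U i l) * C (U j k) * h l k

end LinearTransformation

/-! ### Forms that vanish on the image of a parametrization -/

namespace Param

variable {F : Type*} [Field F] {X Y : Dom} {n : ℕ}

theorem exists_comp_ne_zero (f : Param F X n) : ∃ i, f.comp i ≠ 0 :=
  exists_ne_zero_of_gcd_const f.gcd_const

/-- Substituting the components of a parametrization into a form gives a form. -/
theorem aeval_comp_mem_forms (f : Param F X n) {q : MvPolynomial (Fin (n + 1)) F} {k : ℕ}
    (hq : q.IsHomogeneous k) : aeval f.comp q ∈ X.forms F (k • f.cdeg) := by
  rw [aeval_def, eval₂_eq]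
  refine Submodule.sum_mem _ fun s hs => ?_
  have hk : s.degree = k := by
    by_contra h
    exact mem_support_iff.1 hs (hq.coeff_eq_zero h)
  have hprod : IsWeightedHomogeneous X.weight (∏ i ∈ s.support, f.comp i ^ s i)
      (∑ i ∈ s.support, s i • f.cdeg) :=
    IsWeightedHomogeneous.prod _ _ _ fun i _ => IsWeightedHomogeneous.pow (f.homog i) _
  rw [← Finset.sum_smul, ← Finsupp.degree_apply, hk] at hprod
  exact hprod.C_mul _

theorem eval_aeval_comp (f : Param F X n) (q : MvPolynomial (Fin (n + 1)) F) (a : X.Var → F) :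
    eval a (aeval f.comp q) = eval (fun i => eval a (f.comp i)) q := by
  rw [← aeval_eq_eval, ← aeval_eq_eval, ← AlgHom.comp_apply, comp_aeval]

/-- Passing from the image points to the polynomial identity uses that a polynomial over an infinite
field is determined by its values. -/
theorem aeval_comp_eq_zero_iff_imagePoints [Infinite F] (f : Param F X n)
    {q : MvPolynomial (Fin (n + 1)) F} {d : ℕ} (hq : q.IsHomogeneous d) :
    aeval f.comp q = 0 ↔ ∀ P ∈ imagePoints f.comp, eval P.rep q = 0 := by
  constructor
  · rintro h Q ⟨a, -, hne, rfl⟩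
    rw [eval_rep_mk_eq_zero_iff hq, ← eval_aeval_comp, h, map_zero]
  intro h
  choose x hx using X.factor_surjective
  obtain ⟨i₀, hi₀⟩ := f.exists_comp_ne_zero
  -- the two extra factors exclude the vectors at which `f` is not defined
  have hprod : aeval f.comp q * (f.comp i₀ * ∏ b, MvPolynomial.X (x b)) = 0 := by
    refine MvPolynomial.funext fun a => ?_
    rw [map_zero, map_mul, map_mul]
    by_cases hi : eval a (f.comp i₀) = 0
    · simp [hi]
    by_cases ha : X.IsPoint a
    · have hne : (fun i => eval a (f.comp i)) ≠ 0 := Function.ne_iff.2 ⟨i₀, hi⟩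
      have := h _ ⟨a, ha, hne, rfl⟩
      rw [eval_rep_mk_eq_zero_iff hq] at this
      rw [eval_aeval_comp, this, zero_mul]
    · simp only [Dom.IsPoint, not_forall, not_exists, not_and, not_not] at ha
      obtain ⟨b, hb⟩ := ha
      rw [map_prod, Finset.prod_eq_zero (Finset.mem_univ b) (by rw [eval_X, hb _ (hx b)]),
        mul_zero, mul_zero]
  refine (mul_eq_zero.1 hprod).resolve_right (mul_ne_zero hi₀ ?_)
  exact Finset.prod_ne_zero_iff.2 fun b _ => X_ne_zero _

/-- The points of `img f` are the common zeros of the forms whose pullback along `f` is zero. -/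
theorem mem_img_iff [Infinite F] (f : Param F X n) (P : ℙ F (Fin (n + 1) → F)) :
    P ∈ f.img ↔ ∀ (d : ℕ) (q : MvPolynomial (Fin (n + 1)) F), q.IsHomogeneous d →
      aeval f.comp q = 0 → eval P.rep q = 0 :=
  forall₂_congr fun _ _ => forall_congr' fun hq =>
    imp_congr_left (f.aeval_comp_eq_zero_iff_imagePoints hq).symm

/-- The pullback of a form along `f` is zero if and only if the form vanishes on `img f`; in
particular this depends on `img f` only. -/
theorem aeval_comp_eq_zero_iff [Infinite F] (f : Param F X n)
    {q : MvPolynomial (Fin (n + 1)) F} {d : ℕ} (hq : q.IsHomogeneous d) :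
    aeval f.comp q = 0 ↔ ∀ P ∈ f.img, eval P.rep q = 0 :=
  ⟨fun h P hP => (f.mem_img_iff P).1 hP d q hq h, fun h =>
    (f.aeval_comp_eq_zero_iff_imagePoints hq).2 fun P hP => h P fun _ _ _ hS => hS P hP⟩

/-- Parametrizations have the same image if and only if the same forms on `ℙⁿ` pull back to zero.
The domains may differ, so polynomial identities are transferred from `g` to `f` by this. -/
theorem img_eq_img_iff [Infinite F] (f : Param F X n) (g : Param F Y n) :
    f.img = g.img ↔ ∀ (d : ℕ) (q : MvPolynomial (Fin (n + 1)) F), q.IsHomogeneous d →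
      (aeval f.comp q = 0 ↔ aeval g.comp q = 0) := by
  constructor
  · intro h d q hq
    rw [f.aeval_comp_eq_zero_iff hq, g.aeval_comp_eq_zero_iff hq, h]
  · intro h
    ext P
    rw [mem_img_iff, mem_img_iff]
    exact forall₂_congr fun d q => forall_congr' fun hq => imp_congr_left (h d q hq)

/-! ### Projective linear transformations of parametrizations -/

/-- The parametrization `χ_U ∘ f` for an invertible matrix `U`. -/
noncomputable def transform [Infinite F] (f : Param F X n)
    (U : Matrix (Fin (n + 1)) (Fin (n + 1)) F) (hU : IsUnit U) : Param F X n where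
  comp := (U.map C).mulVec f.comp
  cdeg := f.cdeg
  homog i := by
    rw [map_C_mulVec_apply]
    exact Submodule.sum_mem _ fun j _ => Submodule.smul_mem _ _ (f.homog j)
  gcd_const q hq := f.gcd_const q fun i => by
    rw [← inv_map_mulVec_map_mulVec hU f.comp, map_C_mulVec_apply]
    exact Finset.dvd_sum fun j _ => dvd_smul_of_dvd _ (hq j)
  nondeg a ha h := by
    rw [closure_subset_hyperplane_iff] at h
    refine f.nondeg (Matrix.vecMul a U) ?_ ((closure_subset_hyperplane_iff _ _).2 ?_)
    · intro h0
      exact ha (Matrix.vecMul_injective_of_isUnit hU (h0.trans (Matrix.zero_vecMul U).symm))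
    · have h2 : ∀ j, C (Matrix.vecMul a U j) =
          Matrix.vecMul (fun i => C (σ := X.Var) (a i)) (U.map C) j := by
        intro j
        simp [Matrix.vecMul, dotProduct]
      simp only [h2]
      exact (Matrix.dotProduct_mulVec _ _ _).symm.trans h

/-- The projective linear map with matrix `U` sends `img f` to `img (χ_U ∘ f)`. -/
theorem image_img [Infinite F] (f : Param F X n) {U : Matrix (Fin (n + 1)) (Fin (n + 1)) F}
    {p : ℙ F (Fin (n + 1) → F) ≃ ℙ F (Fin (n + 1) → F)} (hU : IsProjLinear U p) :
    p '' f.img = (f.transform U hU.isUnit).img := by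
  have key : ∀ (P : ℙ F (Fin (n + 1) → F)) {q : MvPolynomial (Fin (n + 1)) F} {d : ℕ},
      q.IsHomogeneous d → (eval (p P).rep q = 0 ↔ eval (U.mulVec P.rep) q = 0) := by
    intro P q d hq
    obtain ⟨h1, h2⟩ := hU P.rep P.rep_nonzero
    rw [Projectivization.mk_rep] at h2
    rw [h2, eval_rep_mk_eq_zero_iff hq]
  have mem : ∀ P, P ∈ f.img ↔ p P ∈ (f.transform U hU.isUnit).img := by
    intro P
    rw [mem_img_iff, mem_img_iff]
    constructor
    · intro h d q hq h0
      rw [key P hq, ← eval_aeval_map_mulVec_X]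
      refine h d _ (isHomogeneous_aeval_map_mulVec_X U hq) ?_
      rw [aeval_aeval_map_mulVec_X]
      exact h0
    · intro h d q hq h0
      have hq' := isHomogeneous_aeval_map_mulVec_X U⁻¹ hq
      have := (key P hq').1 (h d _ hq' ?_)
      · rwa [eval_aeval_map_mulVec_X, Matrix.mulVec_mulVec, Matrix.nonsing_inv_mul _
          ((Matrix.isUnit_iff_isUnit_det _).1 hU.isUnit), Matrix.one_mulVec] at this
      · rw [aeval_aeval_map_mulVec_X, transform, inv_map_mulVec_map_mulVec hU.isUnit, h0]
  ext P
  rw [← p.apply_symm_apply P, Set.mem_image_equiv, ← mem, p.symm_apply_apply]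

/-- The forms `s`, of degree `e b` on the factor `b`, define a rational inverse of `f`:
the data whose existence `Param.IsBirational` asserts. -/
def IsInverse (f : Param F X n) (s : X.Var → MvPolynomial (Fin (n + 1)) F)
    (e : X.Factor → ℕ) : Prop :=
  (∀ x, (s x).IsHomogeneous (e (X.factor x))) ∧
  (∀ b, ∃ x, X.factor x = b ∧ aeval f.comp (s x) ≠ 0) ∧
  (∀ x x', X.factor x = X.factor x' →
    aeval f.comp (s x) * MvPolynomial.X x' = aeval f.comp (s x') * MvPolynomial.X x) ∧
  (∃ i, aeval f.comp (aeval s (f.comp i)) ≠ 0) ∧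
  (∀ i j, aeval f.comp (aeval s (f.comp i)) * f.comp j =
    aeval f.comp (aeval s (f.comp j)) * f.comp i)

/-- If `s` is inverse to `f`, then `s ∘ χ_{U⁻¹}` is inverse to `χ_U ∘ f`. -/
theorem IsBirational.transform [Infinite F] {f : Param F X n} (hf : f.IsBirational)
    {U : Matrix (Fin (n + 1)) (Fin (n + 1)) F} (hU : IsUnit U) :
    (f.transform U hU).IsBirational := by
  obtain ⟨s, e, h1, h2, h3, ⟨i₀, hi₀⟩, h5⟩ := hf
  have key : ∀ q : MvPolynomial (Fin (n + 1)) F,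
      aeval (f.transform U hU).comp (aeval ((U⁻¹.map C).mulVec (MvPolynomial.X (R := F))) q) =
        aeval f.comp q := by
    intro q
    rw [aeval_aeval_map_mulVec_X, Param.transform, inv_map_mulVec_map_mulVec hU]
  have key' : ∀ i, aeval (f.transform U hU).comp (aeval (fun x => aeval ((U⁻¹.map C).mulVec
      (MvPolynomial.X (R := F))) (s x)) ((f.transform U hU).comp i)) =
        (U.map C).mulVec (fun j => aeval f.comp (aeval s (f.comp j))) i := by
    intro i
    rw [← comp_aeval, AlgHom.comp_apply, key, Param.transform, algHom_map_mulVec,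
      algHom_map_mulVec]
  refine ⟨fun x => aeval ((U⁻¹.map C).mulVec (MvPolynomial.X (R := F))) (s x), e,
    fun x => isHomogeneous_aeval_map_mulVec_X _ (h1 x), ?_, ?_, ?_, ?_⟩
  · simpa only [key] using h2
  · simpa only [key] using h3
  · by_contra! h0
    simp only [key'] at h0
    refine hi₀ ?_
    have := congrFun (inv_map_mulVec_map_mulVec hU fun j => aeval f.comp (aeval s (f.comp j))) i₀
    rw [← this, funext h0]
    exact congrFun (Matrix.mulVec_zero _) i₀
  · intro i j
    rw [key', key']
    exact cross_mul_eq_map_mulVec U h5 i j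

end Param

/-! ### Reparametrizations between parametrizations of the same image -/

namespace Param

variable {F : Type*} [Field F] {X Y : Dom} {n : ℕ}

/-- Substituting forms on `ℙⁿ`, of the same degree on each factor, into a form on the domain gives
a form on `ℙⁿ`. -/
theorem isHomogeneous_aeval_of_mem_forms {s : X.Var → MvPolynomial (Fin (n + 1)) F}
    {e : X.Factor → ℕ} (hs : ∀ x, (s x).IsHomogeneous (e (X.factor x)))
    {q : MvPolynomial X.Var F} {d : X.Deg} (hq : q ∈ X.forms F d) :
    (aeval s q).IsHomogeneous (∑ b, d b * e b) := by
  rw [aeval_def, eval₂_eq]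
  refine IsHomogeneous.sum _ _ _ fun u hu => ?_
  have hd : Finsupp.weight X.weight u = d := hq (mem_support_iff.1 hu)
  have hdeg : ∑ b, d b * e b = ∑ i ∈ u.support, e (X.factor i) * u i := by
    simp only [← hd, Finsupp.weight_apply, Finsupp.sum, Finset.sum_apply, Finset.sum_mul,
      Pi.smul_apply, smul_eq_mul]
    rw [Finset.sum_comm]
    refine Finset.sum_congr rfl fun i _ => ?_
    rw [Finset.sum_eq_single (X.factor i)]
    · simp [Dom.weight, mul_comm]
    · intro b _ hb
      simp [Dom.weight, hb]
    · simp
  rw [hdeg]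
  exact (IsHomogeneous.prod _ _ _ fun i _ => (hs i).pow _).C_mul _

/-- The rational map `s ∘ f`, for a tuple `s` of forms on `ℙⁿ` that do not all vanish on `img f`. -/
noncomputable def compRatMap (f : Param F X n) (s : Y.Var → MvPolynomial (Fin (n + 1)) F)
    (e : Y.Factor → ℕ) (hs : ∀ y, (s y).IsHomogeneous (e (Y.factor y)))
    (hne : ∀ b, ∃ y, Y.factor y = b ∧ aeval f.comp (s y) ≠ 0) : RatMap F X Y where
  coord y := aeval f.comp (s y)
  deg b := e b • f.cdeg
  homog y := f.aeval_comp_mem_forms (hs y)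
  nonzero := hne

/-- If `s` is inverse to `g` and `img f = img g`, then `g ∘ (s ∘ f)` equals `f`. -/
theorem IsInverse.cross_mul_eq [Infinite F] {f : Param F X n} {g : Param F Y n}
    (h : f.img = g.img) {s : Y.Var → MvPolynomial (Fin (n + 1)) F} {e : Y.Factor → ℕ}
    (hs : g.IsInverse s e) :
    (∃ i, aeval (fun y => aeval f.comp (s y)) (g.comp i) ≠ 0) ∧
    ∀ i j, aeval (fun y => aeval f.comp (s y)) (g.comp i) * f.comp j =
      aeval (fun y => aeval f.comp (s y)) (g.comp j) * f.comp i := by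
  obtain ⟨h1, -, -, ⟨i₀, hi₀⟩, h5⟩ := hs
  have hv := (img_eq_img_iff f g).1 h
  have hcomp : ∀ i, aeval (fun y => aeval f.comp (s y)) (g.comp i) =
      aeval f.comp (aeval s (g.comp i)) := by
    intro i
    rw [← comp_aeval, AlgHom.comp_apply]
  simp only [hcomp]
  refine ⟨⟨i₀, fun h0 => hi₀ ((hv _ _ (isHomogeneous_aeval_of_mem_forms h1 (g.homog i₀))).1 h0)⟩,
    fun i j => ?_⟩
  have hhom : ∀ i j, (aeval s (g.comp i) * MvPolynomial.X j).IsHomogeneous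
      (∑ b, g.cdeg b * e b + 1) := fun i j =>
    (isHomogeneous_aeval_of_mem_forms h1 (g.homog i)).mul (isHomogeneous_X F j)
  have := (hv _ (aeval s (g.comp i) * MvPolynomial.X j - aeval s (g.comp j) * MvPolynomial.X i)
    ((hhom i j).sub (hhom j i))).2 (by simpa [sub_eq_zero] using h5 i j)
  simpa [sub_eq_zero] using this

/-- If `f` and `g` have the same image, then the map `f⁻¹ ∘ g` is inverse to `g⁻¹ ∘ f`. -/
theorem IsInverse.isLeftInverse [Infinite F] {f : Param F X n} {g : Param F Y n}
    (h : f.img = g.img)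
    {s : X.Var → MvPolynomial (Fin (n + 1)) F} {e : X.Factor → ℕ} (hs : f.IsInverse s e)
    {s' : Y.Var → MvPolynomial (Fin (n + 1)) F} {e' : Y.Factor → ℕ} (hs' : g.IsInverse s' e')
    (hne : ∀ b, ∃ x, X.factor x = b ∧ aeval g.comp (s x) ≠ 0)
    (hne' : ∀ b, ∃ y, Y.factor y = b ∧ aeval f.comp (s' y) ≠ 0) :
    (g.compRatMap s e hs.1 hne).IsLeftInverse (f.compRatMap s' e' hs'.1 hne') := by
  obtain ⟨⟨i₀, hi₀⟩, hcross⟩ := hs'.cross_mul_eq h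
  obtain ⟨h1, h2, h3, -, -⟩ := hs
  obtain ⟨j, hj⟩ := f.exists_comp_ne_zero
  set G : Fin (n + 1) → MvPolynomial X.Var F :=
    fun i => aeval (fun y => aeval f.comp (s' y)) (g.comp i) with hG
  have hGj : G j ≠ 0 := fun h0 => mul_ne_zero hi₀ hj (by
    have := hcross i₀ j
    rw [show aeval (fun y => aeval f.comp (s' y)) (g.comp j) = 0 from h0, zero_mul] at this
    exact this)
  -- the tuple `G = g ∘ r` is proportional to `f`, so forms take proportional values at both
  have hval : ∀ x, f.comp j ^ e (X.factor x) * aeval G (s x) =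
      G j ^ e (X.factor x) * aeval f.comp (s x) := by
    intro x
    rw [← aeval_mul_of_isHomogeneous (h1 x), ← aeval_mul_of_isHomogeneous (h1 x)]
    congr 2
    funext i
    rw [mul_comm]
    exact hcross i j
  have hcoord : ∀ x, aeval (f.compRatMap s' e' hs'.1 hne').coord
      ((g.compRatMap s e h1 hne).coord x) = aeval G (s x) := by
    intro x
    simp only [compRatMap]
    rw [← AlgHom.comp_apply, comp_aeval]
  constructor
  · intro b
    obtain ⟨x, hx, hx0⟩ := h2 b
    refine ⟨x, hx, fun h0 => ?_⟩
    rw [hcoord] at h0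
    have := hval x
    rw [h0, mul_zero] at this
    exact mul_ne_zero (pow_ne_zero _ hGj) hx0 this.symm
  · intro x x' hxx'
    rw [hcoord, hcoord]
    refine mul_left_cancel₀ (pow_ne_zero (e (X.factor x)) hj) ?_
    have h4 := hval x'
    rw [← hxx'] at h4
    rw [← mul_assoc, ← mul_assoc, hval, h4, mul_assoc, mul_assoc, h3 x x' hxx']

/-- Birational parametrizations `f` and `g` of the same image differ by the birational
reparametrization `g⁻¹ ∘ f`. -/
theorem exists_birMap [Infinite F] {f : Param F X n} {g : Param F Y n} (hf : f.IsBirational)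
    (hg : g.IsBirational) (h : f.img = g.img) :
    ∃ r : BirMap F X Y, ∀ i j, aeval r.coord (g.comp i) * f.comp j =
      aeval r.coord (g.comp j) * f.comp i := by
  obtain ⟨s, e, hs⟩ : ∃ s e, f.IsInverse s e := hf
  obtain ⟨s', e', hs'⟩ : ∃ s e, g.IsInverse s e := hg
  have hv := (img_eq_img_iff f g).1 h
  have hne : ∀ b, ∃ x, X.factor x = b ∧ aeval g.comp (s x) ≠ 0 := fun b => by
    obtain ⟨x, hx, h0⟩ := hs.2.1 b
    exact ⟨x, hx, fun h1 => h0 ((hv _ _ (hs.1 x)).2 h1)⟩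
  have hne' : ∀ b, ∃ y, Y.factor y = b ∧ aeval f.comp (s' y) ≠ 0 := fun b => by
    obtain ⟨y, hy, h0⟩ := hs'.2.1 b
    exact ⟨y, hy, fun h1 => h0 ((hv _ _ (hs'.1 y)).1 h1)⟩
  exact ⟨⟨f.compRatMap s' e' hs'.1 hne', g.compRatMap s e hs.1 hne,
    hs.isLeftInverse h hs' hne hne', hs'.isLeftInverse h.symm hs hne' hne⟩,
    (hs'.cross_mul_eq h).2⟩

/-! ### Compositions with reparametrizations -/

/-- Composition with a birational map does not change the image. -/
theorem img_compBir [IsAlgClosed F] (g : Param F Y n) (r : BirMap F X Y) :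
    (g.compBir r).img = g.img := by
  have : Infinite F := IsAlgClosed.instInfinite
  obtain ⟨q, hq, hqr⟩ := g.compBir_spec r
  refine (img_eq_img_iff _ _).2 fun d u hu => ?_
  have h1 : aeval r.coord (aeval g.comp u) = q ^ d * aeval (g.compBir r).comp u := by
    rw [← aeval_mul_of_isHomogeneous hu, ← AlgHom.comp_apply, comp_aeval]
    congr 2
    funext i
    exact hqr i
  constructor
  · intro h0
    refine r.eq_zero_of_aeval (g.aeval_comp_mem_forms hu) ?_
    rw [h1, h0, mul_zero]
  · intro h0
    rw [h0, map_zero] at h1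
    exact (mul_eq_zero.1 h1.symm).resolve_left (pow_ne_zero _ hq)

/-- Representatives of the same birational map have proportional compositions with `g`. -/
theorem cross_mul_eq_of_eqv (g : Param F Y n) {r s : BirMap F X Y} (h : r.Eqv s)
    (i j : Fin (n + 1)) :
    aeval r.coord (g.comp i) * aeval s.coord (g.comp j) =
      aeval r.coord (g.comp j) * aeval s.coord (g.comp i) := by
  choose y hy hne using s.nonzero
  have key : ∀ i, (∏ b, s.coord (y b) ^ g.cdeg b) * aeval r.coord (g.comp i) =
      (∏ b, r.coord (y b) ^ g.cdeg b) * aeval s.coord (g.comp i) := by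
    intro i
    rw [← Y.aeval_smul_forms (g.homog i) (fun b => s.coord (y b)),
      ← Y.aeval_smul_forms (g.homog i) (fun b => r.coord (y b))]
    congr 2
    funext z
    rw [mul_comm]
    exact h z _ (hy _).symm
  have hA : ∏ b, s.coord (y b) ^ g.cdeg b ≠ 0 :=
    Finset.prod_ne_zero_iff.2 fun b _ => pow_ne_zero _ (hne b)
  refine mul_left_cancel₀ hA ?_
  rw [← mul_assoc, ← mul_assoc, key, key]
  ring

/-- If `f` is proportional to `g ∘ s` and `r` represents the same birational map as `s`, then
the components of `g ∘ r` are those of `f`, up to a common nonzero scalar. -/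
theorem exists_compBir_comp_eq [IsAlgClosed F] {f : Param F X n} {g : Param F Y n}
    {r s : BirMap F X Y} (h : r.Eqv s)
    (hs : ∀ i j, aeval s.coord (g.comp i) * f.comp j = aeval s.coord (g.comp j) * f.comp i) :
    ∃ c : F, c ≠ 0 ∧ ∀ i, (g.compBir r).comp i = C c * f.comp i := by
  obtain ⟨q, hq, hqr⟩ := g.compBir_spec r
  refine exists_eq_C_mul_of_cross_mul_eq f.gcd_const (g.compBir r).gcd_const fun i j => ?_
  obtain ⟨k, hk⟩ := g.exists_comp_ne_zero
  have hk' : aeval s.coord (g.comp k) ≠ 0 := fun h0 => hk (s.eq_zero_of_aeval (g.homog k) h0)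
  have h1 : ∀ i j, (g.compBir r).comp i * aeval s.coord (g.comp j) =
      (g.compBir r).comp j * aeval s.coord (g.comp i) := by
    intro i j
    have := g.cross_mul_eq_of_eqv h i j
    rw [hqr, hqr, mul_assoc, mul_assoc] at this
    exact mul_left_cancel₀ hq this
  refine mul_left_cancel₀ (mul_ne_zero hk' hk') ?_
  linear_combination (-aeval s.coord (g.comp k) * (g.compBir r).comp j) * hs i k +
    (aeval s.coord (g.comp k) * (g.compBir r).comp i) * hs j k -
    (aeval s.coord (g.comp k) * f.comp k) * h1 i j

theorem cdeg_eq_of_mem_forms (f : Param F X n) {d : X.Deg}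
    (h : ∀ i, f.comp i ∈ X.forms F d) : f.cdeg = d := by
  obtain ⟨i, hi⟩ := f.exists_comp_ne_zero
  exact IsWeightedHomogeneous.inj_right hi (f.homog i) (h i)

/-- The base points depend only on the span of the components. -/
theorem basePoints_eq_of_assocSpace_eq {f g : Param F X n} (h : f.assocSpace = g.assocSpace) :
    f.basePoints = g.basePoints := by
  rw [basePoints, basePoints, h]

theorem assocSpace_le_of_mulVec {f h : Param F X n} {U : Matrix (Fin (n + 1)) (Fin (n + 1)) F}
    (hU : h.comp = (U.map C).mulVec f.comp) : h.assocSpace ≤ f.assocSpace := by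
  refine Submodule.span_le.2 ?_
  rintro _ ⟨i, rfl⟩
  rw [hU, map_C_mulVec_apply]
  exact Submodule.sum_mem _ fun j _ => Submodule.smul_mem _ _ (Submodule.subset_span ⟨j, rfl⟩)

theorem basePoints_eq_of_mulVec {f h : Param F X n} {U : Matrix (Fin (n + 1)) (Fin (n + 1)) F}
    (hU : IsUnit U) (hh : h.comp = (U.map C).mulVec f.comp) : h.basePoints = f.basePoints :=
  basePoints_eq_of_assocSpace_eq ((assocSpace_le_of_mulVec hh).antisymm
    (assocSpace_le_of_mulVec (U := U⁻¹) (by rw [hh, inv_map_mulVec_map_mulVec hU])))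

/-! ### Coefficient matrices -/

/-- The coefficient matrices satisfy `M_h = U * M_f` if and only if `h = χ_U ∘ f` as tuples of
forms. The degree hypotheses exclude the junk value of `coeffMatrix`. -/
theorem coeffMatrix_eq_mul_iff {f h : Param F X n} {d : X.Deg} {ι : Type*} [Fintype ι]
    (v : Module.Basis ι F (X.forms F d)) (hf : f.cdeg = d) (hh : h.cdeg = d)
    (U : Matrix (Fin (n + 1)) (Fin (n + 1)) F) :
    coeffMatrix v h = U * coeffMatrix v f ↔ h.comp = (U.map C).mulVec f.comp := by
  subst hf
  have hf' : ∀ i, f.comp i ∈ X.forms F f.cdeg := f.homog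
  have hh' : ∀ i, h.comp i ∈ X.forms F f.cdeg := hh ▸ h.homog
  have hcoeff : ∀ i j, (U * coeffMatrix v f) i j =
      v.repr (∑ k, U i k • ⟨f.comp k, hf' k⟩) j := by
    intro i j
    simp only [Matrix.mul_apply, coeffMatrix, hf', map_sum, map_smul, Matrix.of_apply,
      Finsupp.coe_finsetSum, Finset.sum_apply, Finsupp.smul_apply, smul_eq_mul, dite_true]
  have hcoeff' : ∀ i j, coeffMatrix v h i j = v.repr ⟨h.comp i, hh' i⟩ j := by
    intro i j
    simp [coeffMatrix, hh']
  have hval : ∀ i, ((∑ k, U i k • (⟨f.comp k, hf' k⟩ : X.forms F f.cdeg) : X.forms F f.cdeg) :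
      MvPolynomial X.Var F) = (U.map C).mulVec f.comp i := by
    intro i
    simp [map_C_mulVec_apply]
  constructor
  · intro heq
    funext i
    rw [← hval]
    refine congrArg Subtype.val (v.repr.injective (Finsupp.ext fun j => ?_)) (a₁ := ⟨_, hh' i⟩)
    rw [← hcoeff, ← hcoeff', heq]
  · intro heq
    ext i j
    rw [hcoeff, hcoeff']
    congr 2
    exact Subtype.ext ((congrFun heq i).trans (hval i).symm)

end Param

theorem fromBlocks_mul_augmented_eq_iff {F : Type*} [Field F] {m ι κ : Type*} [Fintype m]
    [Fintype κ] [DecidableEq κ] (U : Matrix m m F) (M N : Matrix m ι F) (K : Matrix ι κ F) :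
    (Matrix.fromBlocks U 0 0 1 : Matrix (m ⊕ κ) (m ⊕ κ) F) * augmented M K = augmented N K ↔
      N = U * M := by
  rw [augmented, augmented, Matrix.transpose_fromCols, Matrix.transpose_fromCols,
    Matrix.fromBlocks_mul_fromRows, Matrix.fromRows_ext_iff]
  simp [eq_comm]

theorem mul_eq_iff_eq_mul_nonsing_inv {F : Type*} [Field F] {ι : Type*} [Fintype ι]
    [DecidableEq ι] {E : Matrix ι ι F} (hE : IsUnit E) (A B : Matrix ι ι F) :
    A * E = B ↔ A = B * E⁻¹ := by
  have hdet := (Matrix.isUnit_iff_isUnit_det _).1 hE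
  constructor
  · rintro rfl
    rw [Matrix.mul_nonsing_inv_cancel_right _ _ hdet]
  · rintro rfl
    rw [Matrix.nonsing_inv_mul_cancel_right _ _ hdet]

theorem IsKernelMatrix.mul_eq_zero {F : Type*} [Field F] {m ι κ : Type*} [Fintype ι]
    {M : Matrix m ι F} {K : Matrix ι κ F} (hK : IsKernelMatrix M K) : M * K = 0 := by
  ext i j
  have : K.col j ∈ LinearMap.ker M.mulVecLin := hK.2 ▸ Submodule.subset_span ⟨j, rfl⟩
  exact congrFun (LinearMap.mem_ker.1 this) i

/-! ### Projective isomorphisms -/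

section Main

variable {F : Type*} [Field F] [IsAlgClosed F] {X Y : Dom} {n : ℕ}

/-- Every projective isomorphism of the images comes from a reparametrization `r`: its matrix can
be scaled such that it transforms `f` to `g ∘ r`. -/
theorem exists_comp_eq_of_mem_projIsos {f : Param F X n} {g : Param F Y n} (hf : f.IsBirational)
    (hg : g.IsBirational) {I : Type*} {r : I → BirMap F X Y}
    (hS : ∀ ρ ∈ compatibleReparams f g, ∃ c : I, (r c).Eqv ρ)
    {p : ℙ F (Fin (n + 1) → F) ≃ ℙ F (Fin (n + 1) → F)} (hp : p ∈ projIsos f g) :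
    ∃ U, IsProjLinear U p ∧ ∃ c, (g.compBir (r c)).comp = (U.map C).mulVec f.comp := by
  have : Infinite F := IsAlgClosed.instInfinite
  obtain ⟨U, hU⟩ := exists_isProjLinear_of_mem_projAut hp.1
  obtain ⟨ρ, hρ⟩ := Param.exists_birMap (hf.transform hU.isUnit) hg
    ((f.image_img hU).symm.trans hp.2)
  obtain ⟨c, hc⟩ := hS ρ ⟨p, hp, fun a _ _ hfa hga => by
    obtain ⟨h1, h2⟩ := hU _ hfa
    rw [h2, mk_eq_mk_iff_cross_mul_eq]
    intro i j
    have h3 := congrArg (eval a) (hρ j i)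
    have h4 : ∀ k, eval a (aeval ρ.coord (g.comp k)) =
        eval (fun y => eval a (ρ.coord y)) (g.comp k) := by
      intro k
      rw [← aeval_eq_eval, ← aeval_eq_eval, ← AlgHom.comp_apply, comp_aeval]
    simp only [map_mul, h4, Param.transform, eval_map_mulVec] at h3
    rw [mul_comm, h3, mul_comm]⟩
  obtain ⟨u, hu, huc⟩ := Param.exists_compBir_comp_eq hc hρ
  refine ⟨u • U, hU.smul hu, c, funext fun i => ?_⟩
  have h1 : (f.transform U hU.isUnit).comp i = (U.map C).mulVec f.comp i := rfl
  rw [huc, h1, map_C_mulVec_apply, map_C_mulVec_apply, ← smul_eq_C_mul, Finset.smul_sum]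
  simp only [Matrix.smul_apply, smul_assoc]

/-- A projective linear map with matrix `U` that transforms `f` to `g ∘ r` is a projective
isomorphism, since `r` does not change the image. -/
theorem mem_projIsos_of_comp_eq {f : Param F X n} {g : Param F Y n} {r : BirMap F X Y}
    {U : Matrix (Fin (n + 1)) (Fin (n + 1)) F}
    {p : ℙ F (Fin (n + 1) → F) ≃ ℙ F (Fin (n + 1) → F)} (hp : p ∈ projAut F n)
    (hU : IsProjLinear U p) (h : (g.compBir r).comp = (U.map C).mulVec f.comp) :
    p ∈ projIsos f g := by
  have : Infinite F := IsAlgClosed.instInfinite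
  refine ⟨hp, ?_⟩
  rw [f.image_img hU, ← g.img_compBir r, Param.img, Param.img, h]
  rfl

/-- The set of projective isomorphisms, for the basis and the kernel matrix indexed by arbitrary
finite types. -/
theorem projIsos_eq {f : Param F X n} {g : Param F Y n} (hf : f.IsBirational)
    (hg : g.IsBirational) {I : Type*} {r : I → BirMap F X Y}
    (hS : ∀ ρ ∈ compatibleReparams f g, ∃ c : I, (r c).Eqv ρ)
    {ι κ : Type*} [Fintype ι] [Fintype κ] [DecidableEq κ]
    (v : Module.Basis ι F (X.forms F f.cdeg)) {K : Matrix ι κ F}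
    (hK : IsKernelMatrix (coeffMatrix v f) K) :
    projIsos f g =
      {p | p ∈ projAut F n ∧ ∃ U : Matrix (Fin (n + 1)) (Fin (n + 1)) F, IsProjLinear U p ∧
        ∃ c ∈ indexSet f g r v K,
          (Matrix.fromBlocks U 0 0 1 : Matrix (Fin (n + 1) ⊕ κ) (Fin (n + 1) ⊕ κ) F) *
              augmented (coeffMatrix v f) K =
            augmented (coeffMatrix v (g.compBir (r c))) K} := by
  have : Infinite F := IsAlgClosed.instInfinite
  ext p
  constructor
  · intro hp
    obtain ⟨U, hU, c, hc⟩ := exists_comp_eq_of_mem_projIsos hf hg hS hp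
    have hdeg : (g.compBir (r c)).cdeg = f.cdeg :=
      (g.compBir (r c)).cdeg_eq_of_mem_forms fun i => hc ▸ (f.transform U hU.isUnit).homog i
    have hM := (Param.coeffMatrix_eq_mul_iff v rfl hdeg U).2 hc
    refine ⟨hp.1, U, hU, c, ⟨Param.basePoints_eq_of_mulVec hU.isUnit hc, hdeg, ?_⟩,
      (fromBlocks_mul_augmented_eq_iff _ _ _ _).2 hM⟩
    rw [hM, Matrix.mul_assoc, hK.mul_eq_zero, Matrix.mul_zero]
  · rintro ⟨hp, U, hU, c, ⟨-, hdeg, -⟩, hE⟩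
    exact mem_projIsos_of_comp_eq hp hU ((Param.coeffMatrix_eq_mul_iff v rfl hdeg U).1
      ((fromBlocks_mul_augmented_eq_iff _ _ _ _).1 hE))

end Main

/-- The basis `v` of the forms of degree `cdeg f` has `m = (n + 1) + k` elements and is indexed by
`Fin (n + 1) ⊕ Fin k`, so that the augmented matrices `E` are square with two blocks of rows. -/
theorem mainTheorem3 {F : Type*} [Field F] [IsAlgClosed F] {X Y : Dom} {n : ℕ}
    (f : Param F X n) (g : Param F Y n) (hf : f.IsBirational) (hg : g.IsBirational)
    {t : ℕ} (I : Set (Fin t → F)) (r : I → BirMap F X Y)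
    (hS : ∀ ρ ∈ compatibleReparams f g, ∃ c : I, (r c).Eqv ρ)
    {k : ℕ} (v : Module.Basis (Fin (n + 1) ⊕ Fin k) F (X.forms F f.cdeg))
    (K : Matrix (Fin (n + 1) ⊕ Fin k) (Fin k) F) (hK : IsKernelMatrix (coeffMatrix v f) K) :
    projIsos f g =
        {p | p ∈ projAut F n ∧ ∃ U : Matrix (Fin (n + 1)) (Fin (n + 1)) F, IsProjLinear U p ∧
          ∃ c ∈ indexSet f g r v K,
            Matrix.fromBlocks U 0 0 1 * augmented (coeffMatrix v f) K =
              augmented (coeffMatrix v (g.compBir (r c))) K} ∧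
      (IsUnit (augmented (coeffMatrix v f) K) →
        projIsos f g =
          {p | p ∈ projAut F n ∧ ∃ U : Matrix (Fin (n + 1)) (Fin (n + 1)) F, IsProjLinear U p ∧
            ∃ c ∈ indexSet f g r v K,
              Matrix.fromBlocks U 0 0 1 =
                augmented (coeffMatrix v (g.compBir (r c))) K *
                  (augmented (coeffMatrix v f) K)⁻¹}) := by
  refine ⟨projIsos_eq hf hg hS v hK, fun hE => (projIsos_eq hf hg hS v hK).trans ?_⟩
  ext p
  -- the products in the statement elaborate to those of the type synonym `CStarMatrix`, which agree
  -- with the products of matrices by definition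
  exact and_congr_right fun _ => exists_congr fun U => and_congr_right fun _ =>
    exists_congr fun c => and_congr_right fun _ => mul_eq_iff_eq_mul_nonsing_inv hE _ _
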